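/- Let $j$ be Klein's modular function on the upper half-plane $\mathbb H$, normalized by $j(\tau)=q^{-1}+744+196884q+\cdots$ with $q=e^{2\pi i\tau}$, and let $\zeta=e^{2\pi i/6}$. Let $\mathcal F=\{\tau\in\mathbb H : |\mathrm{Re}\,\tau|\le 1/2,\ |\tau|\ge 1\}$ and $\mathcal F_+=\{\tau\in\mathcal F : 0\le \mathrm{Re}\,\tau\le 1/2\}$. The boundary $\partial\mathcal F_+$ is the union of three geodesics: the parts of $\mathcal F_+$ on the line $\mathrm{Re}\,\tau=0$, on the line $\mathrm{Re}\,\tau=1/2$, and on the unit circle. Let $\xi\in\mathcal F_+$ with $\xi\ne\zeta$. Put $A=|j''(i)|$ if $\xi=i$ and $A=|j'(\xi)|$ otherwise, and put $B=4\cdot 10^5\max\{1,|j(\xi)|\}$. Let $\delta$ be the minimum of $\frac{A}{12A+108B}$ and of half the Euclidean distances from $\xi$ to those of the three geodesics that do not contain $\xi$. Define $$c(\xi)=\begin{cases} A\delta/2 & \text{if } \xi\in\partial\mathcal F_+\setminus\{i\},\\ A\delta^2/4 & \text{if } \xi=i,\\ \min\{|\mathrm{Im}\,j(\xi)|,\,A\delta/2\}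 & \text{otherwise.}\end{cases}$$ Then $c(\xi)>0$, and for every $\tau\in\mathcal F_+$ with $|\tau-\xi|\ge\delta$ we have $$|j(\tau)-j(\xi)|\ge c(\xi).$$ -/

import Mathlib

noncomputable section

namespace JBound

/-- Klein's `j`-function `j(τ) = E₄(τ)³ / Δ(τ) = q⁻¹ + 744 + 196884 q + ⋯`, with `q = e^{2πiτ}`
and `Δ(τ) = q ∏ (1 - qⁿ)²⁴`, as a function of a complex variable. It is only meaningful
(and only used) on the open upper half-plane. -/
def j (τ : ℂ) : ℂ :=
  ModularForm.E₄ (UpperHalfPlane.ofComplex τ) ^ 3 /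
    ModularForm.discriminant (UpperHalfPlane.ofComplex τ)

/-- The point `ζ = e^{2πi/6} = 1/2 + i√3/2`. -/
def zeta : ℂ := Complex.exp (2 * Real.pi * Complex.I / 6)

/-- The classical closed fundamental domain `{τ ∈ ℍ : |Re τ| ≤ 1/2, |τ| ≥ 1}`,
as a subset of `ℂ`. -/
def F : Set ℂ := (fun z : UpperHalfPlane => (z : ℂ)) '' ModularGroup.fd

/-- The right half `F₊` of the fundamental domain. -/
def Fplus : Set ℂ := {τ ∈ F | 0 ≤ τ.re ∧ τ.re ≤ 1 / 2}

/-- The side of `F₊` on the imaginary axis. -/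
def leftSide : Set ℂ := {τ ∈ Fplus | τ.re = 0}

/-- The side of `F₊` on the line `Re τ = 1/2`. -/
def rightSide : Set ℂ := {τ ∈ Fplus | τ.re = 1 / 2}

/-- The side of `F₊` on the unit circle. -/
def arcSide : Set ℂ := {τ ∈ Fplus | ‖τ‖ = 1}

/-- The three geodesics that make up the boundary of `F₊`. -/
def sides : Set (Set ℂ) := {leftSide, rightSide, arcSide}

open Classical in
/-- `A = |j''(i)|` if `ξ = i`, and `A = |j'(ξ)|` otherwise. -/
def A (ξ : ℂ) : ℝ := if ξ = Complex.I then ‖iteratedDeriv 2 j Complex.I‖ else ‖deriv j ξ‖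

/-- `B = 4·10⁵ max{1, |j(ξ)|}`. -/
def B (ξ : ℂ) : ℝ := 4 * 10 ^ 5 * max 1 ‖j ξ‖

/-- The numbers of which `δ` is the minimum: `A / (12A + 108B)`, and half the Euclidean distance
from `ξ` to each side of `F₊` not containing `ξ`. -/
def deltaCandidates (ξ : ℂ) : Set ℝ :=
  insert (A ξ / (12 * A ξ + 108 * B ξ))
    ((fun g => Metric.infDist ξ g / 2) '' {g ∈ sides | ξ ∉ g})

/-- `δ`, the minimum of the finite nonempty set `deltaCandidates ξ`. -/
def delta (ξ : ℂ) : ℝ := sInf (deltaCandidates ξ)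

theorem delta_isLeast (ξ : ℂ) : IsLeast (deltaCandidates ξ) (delta ξ) := by
  have hf : (deltaCandidates ξ).Finite := by
    refine Set.Finite.insert _ (Set.Finite.image _ (Set.Finite.subset ?_ (Set.sep_subset _ _)))
    unfold sides
    exact Set.toFinite _
  have hn : (deltaCandidates ξ).Nonempty := Set.insert_nonempty _ _
  exact ⟨hn.csInf_mem hf, fun x hx => csInf_le hf.bddBelow hx⟩

open Classical in
/-- The constant `c(ξ)`, for `ξ ∈ F₊`. -/
def c (ξ : ℂ) : ℝ :=
  if ξ = Complex.I then A ξ * delta ξ ^ 2 / 4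
  else if ξ ∈ frontier Fplus then A ξ * delta ξ / 2
  else min |(j ξ).im| (A ξ * delta ξ / 2)

end JBound

end

noncomputable section

namespace JBound

open Complex Filter Topology
open scoped Real UpperHalfPlane

/-! Outside the disc of radius δ about `ξ`, the function `1/(j - j(ξ))` is holomorphic on `F₊` and
tends to 0 at `i∞`. By the maximum principle (`le_norm_j_sub_of_boundary`) it is enough to bound `|j
- j(ξ)|` from below on the circle `|z - ξ| = δ` and on the part of `∂F₊` outside the disc.

On the circle, `j - j(ξ)` is compared with its leading Taylor term, of degree 1, or 2 at `i`. A
Schwarz lemma on the disc of radius 1/6 makes the remainder at most half of that term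
(`half_le_norm_sub_of_leading_term`); `B` bounds `j - j(ξ)` there through explicit estimates of the
`q`-series and the `q`-product.

On `∂F₊` the function `j` is real. For interior `ξ` the distance is therefore at least `|Im j(ξ)|`.
For `ξ` on the boundary, `j` is monotone along the boundary (`monotone_re_j_bdryPath`), so the
minimum outside the disc is controlled by the points where the boundary path crosses the circle.

What remains is the geometry of `j` on `F₊`. The maximum principle applied to `exp(-ij)` and
`exp(j')` gives `Im j < 0` and `Re j' < 0` inside. The second makes `j` injective on convex subsets,
and an open-closed argument in the lower half-plane extends this to the whole interior. The first
limits the order of `j - j(ξ)` at a boundary point by the angle of `F₊` there, so that `A ≠ 0`. -/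

/-! ### The `q`-expansion and the symmetries of `j` -/

/-- The nome `q = e^{2πiz}`. -/
def nome (z : ℂ) : ℂ := cexp (2 * π * I * z)

lemma nome_ne_zero (z : ℂ) : nome z ≠ 0 := exp_ne_zero _

lemma norm_nome (z : ℂ) : ‖nome z‖ = Real.exp (-(2 * π * z.im)) := by
  simp [nome, norm_exp]

lemma norm_nome_lt_one {z : ℂ} (hz : 0 < z.im) : ‖nome z‖ < 1 := by
  rw [norm_nome, Real.exp_lt_one_iff]
  have := Real.pi_pos
  nlinarith [mul_pos this hz]

lemma qParam_one_eq_nome (z : ℂ) : Function.Periodic.qParam 1 z = nome z := by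
  simp [Function.Periodic.qParam, nome]

lemma nome_add_one (z : ℂ) : nome (z + 1) = nome z := by
  simp only [nome, mul_add, mul_one]
  exact exp_periodic _

lemma nome_neg_conj (z : ℂ) : nome (-(starRingEnd ℂ) z) = (starRingEnd ℂ) (nome z) := by
  simp [nome, ← exp_conj, conj_ofNat]

lemma j_apply {z : ℂ} (hz : 0 < z.im) :
    j z = ModularForm.E₄ ⟨z, hz⟩ ^ 3 / ModularForm.discriminant ⟨z, hz⟩ := by
  simp [j, UpperHalfPlane.ofComplex_apply_of_im_pos hz]

/-- The `q`-product `∏ (1 - qⁿ)`. -/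
def eulerProd (q : ℂ) : ℂ := ∏' n : ℕ, (1 - q ^ (n + 1))

/-- The `q`-series of `E₄ - 1`. -/
def eisSeries (q : ℂ) : ℂ := ∑' n : ℕ, (240 * ArithmeticFunction.sigma 3 (n + 1) : ℂ) * q ^ (n + 1)

lemma norm_eisSeries_term_le (q : ℂ) (n : ℕ) :
    ‖(240 * ArithmeticFunction.sigma 3 (n + 1) : ℂ) * q ^ (n + 1)‖
      ≤ 240 * ‖q‖ * (16 * ‖q‖) ^ n := by
  have h1 : ArithmeticFunction.sigma 3 (n + 1) ≤ 16 ^ n := by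
    refine (ArithmeticFunction.sigma_le_pow_succ 3 (n + 1)).trans ?_
    -- `σ₃(m) ≤ m⁴` with `m = n + 1 ≤ 2ⁿ`; this crude geometric growth suffices because only `|q| ≤
    -- 1/80` is needed.
    rw [show (16 : ℕ) ^ n = (2 ^ n) ^ (3 + 1) by rw [← pow_mul, mul_comm, pow_mul]; norm_num]
    exact Nat.pow_le_pow_left Nat.lt_two_pow_self _
  have h2 : (ArithmeticFunction.sigma 3 (n + 1) : ℝ) ≤ 16 ^ n := by exact_mod_cast h1
  rw [norm_mul, norm_mul, norm_pow, Complex.norm_natCast, pow_succ, mul_pow]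
  simp only [Complex.norm_ofNat]
  calc 240 * (ArithmeticFunction.sigma 3 (n + 1) : ℝ) * (‖q‖ ^ n * ‖q‖)
      ≤ 240 * 16 ^ n * (‖q‖ ^ n * ‖q‖) := by gcongr
    _ = _ := by ring

lemma norm_eisSeries_le {q : ℂ} (hq : ‖q‖ < 1 / 16) :
    ‖eisSeries q‖ ≤ 240 * ‖q‖ / (1 - 16 * ‖q‖) := by
  have hs := (hasSum_geometric_of_lt_one (r := 16 * ‖q‖) (by positivity) (by linarith)).mul_left
    (240 * ‖q‖)
  exact tsum_of_norm_bounded hs (norm_eisSeries_term_le q)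

lemma E4_eq {z : ℂ} (hz : 0 < z.im) : ModularForm.E₄ ⟨z, hz⟩ = 1 + eisSeries (nome z) := by
  have h := EisensteinSeries.q_expansion_bernoulli (k := 4) (by norm_num) (by decide) ⟨z, hz⟩
  simp only [zpow_natCast] at h
  rw [h, bernoulli_eq_bernoulli'_of_ne_one (by norm_num), bernoulli'_four,
    tsum_pnat_eq_tsum_succ (f := fun n ↦ (ArithmeticFunction.sigma (4 - 1) n : ℂ) *
      cexp (2 * π * I * z) ^ n), eisSeries, sub_eq_add_neg, ← neg_mul, ← tsum_mul_left]
  congr 2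
  ext n
  simp only [nome]
  push_cast
  ring

lemma discriminant_eq {z : ℂ} (hz : 0 < z.im) :
    ModularForm.discriminant ⟨z, hz⟩ = nome z * eulerProd (nome z) ^ 24 := by
  rw [ModularForm.discriminant_eq_q_prod]
  simp only [ModularForm.eta_q, qParam_one_eq_nome, eulerProd]
  rw [(ModularForm.multipliable_one_sub_pow (norm_nome_lt_one hz)).tprod_pow]

lemma eulerProd_ne_zero {z : ℂ} (hz : 0 < z.im) : eulerProd (nome z) ≠ 0 := by
  simpa [eulerProd, ModularForm.eta_q, qParam_one_eq_nome] using ModularForm.eta_tprod_ne_zero hz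

lemma j_eq {z : ℂ} (hz : 0 < z.im) :
    j z = (1 + eisSeries (nome z)) ^ 3 / (nome z * eulerProd (nome z) ^ 24) := by
  rw [j_apply hz, E4_eq, discriminant_eq]

lemma eisSeries_conj (q : ℂ) : eisSeries ((starRingEnd ℂ) q) = (starRingEnd ℂ) (eisSeries q) := by
  simp [eisSeries, Complex.conj_tsum, conj_ofNat]

lemma eulerProd_conj {q : ℂ} (hq : ‖q‖ < 1) :
    eulerProd ((starRingEnd ℂ) q) = (starRingEnd ℂ) (eulerProd q) := by
  rw [eulerProd, eulerProd, (ModularForm.multipliable_one_sub_pow hq).map_tprod _ continuous_conj]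
  simp

theorem j_add_one {z : ℂ} (hz : 0 < z.im) : j (z + 1) = j z := by
  rw [j_eq hz, j_eq (by simpa using hz), nome_add_one]

theorem j_neg_conj {z : ℂ} (hz : 0 < z.im) :
    j (-(starRingEnd ℂ) z) = (starRingEnd ℂ) (j z) := by
  rw [j_eq hz, j_eq (by simpa using hz), nome_neg_conj, eisSeries_conj,
    eulerProd_conj (norm_nome_lt_one hz)]
  simp

theorem j_neg_inv {z : ℂ} (hz : 0 < z.im) : j (-z⁻¹) = j z := by
  have hz0 : z ≠ 0 := by rintro rfl; simp at hz
  have him : 0 < (-z⁻¹).im := by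
    simpa [neg_div] using div_pos hz (normSq_pos.2 hz0)
  have hS : ModularGroup.S • (⟨z, hz⟩ : ℍ) = ⟨-z⁻¹, him⟩ := by
    rw [UpperHalfPlane.modular_S_smul]
    ext1
    simp
  have hE : ModularForm.E₄ ⟨-z⁻¹, him⟩ = z ^ 4 * ModularForm.E₄ ⟨z, hz⟩ := by
    have h := congrFun (SlashInvariantFormClass.slash_action_eq (ModularForm.E₄)
      (Matrix.SpecialLinearGroup.mapGL ℝ ModularGroup.S) ⟨_, rfl⟩) ⟨z, hz⟩
    have h' := (ModularForm.SL_slash_apply (k := 4) ModularForm.E₄ ModularGroup.S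
      ⟨z, hz⟩).symm.trans h
    rw [hS, ModularGroup.denom_S] at h'
    rw [← h']
    simp
    field_simp
  have hD : ModularForm.discriminant ⟨-z⁻¹, him⟩ = z ^ 12 * ModularForm.discriminant ⟨z, hz⟩ := by
    have h := congrFun ModularForm.discriminant_S_invariant ⟨z, hz⟩
    rw [ModularForm.SL_slash_apply, hS, ModularGroup.denom_S] at h
    rw [← h]
    simp
    field_simp
  rw [j_apply hz, j_apply him, hE, hD]
  have := ModularForm.discriminant_ne_zero ⟨z, hz⟩
  field_simp

/-! ### Holomorphy at the cusp and the derivative of `j` -/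

/-- The holomorphic function `q ↦ q j` on the unit disc. -/
def qj (q : ℂ) : ℂ :=
  UpperHalfPlane.cuspFunction 1 ModularForm.E₄ q ^ 3 / eulerProd q ^ 24

lemma eulerProd_zero : eulerProd 0 = 1 := by simp [eulerProd]

lemma exists_nome_eq {q : ℂ} (hq : ‖q‖ < 1) (h0 : q ≠ 0) : ∃ z : ℂ, 0 < z.im ∧ nome z = q := by
  refine ⟨Function.Periodic.invQParam 1 q,
    Function.Periodic.im_invQParam_pos_of_norm_lt_one one_pos hq h0, ?_⟩
  rw [← qParam_one_eq_nome, Function.Periodic.qParam_right_inv one_ne_zero h0]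

lemma eulerProd_ne_zero' {q : ℂ} (hq : ‖q‖ < 1) : eulerProd q ≠ 0 := by
  rcases eq_or_ne q 0 with rfl | h0
  · simp [eulerProd_zero]
  · obtain ⟨z, hz, rfl⟩ := exists_nome_eq hq h0
    exact eulerProd_ne_zero hz

lemma differentiableOn_qj : DifferentiableOn ℂ qj (Metric.ball 0 1) := by
  refine DifferentiableOn.div (DifferentiableOn.fun_pow (fun q hq ↦ ?_) 3)
    (ModularForm.differentiableOn_tprod_one_sub_pow.fun_pow 24)
    fun q hq ↦ pow_ne_zero _ (eulerProd_ne_zero' (by simpa using hq))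
  exact (ModularFormClass.differentiableAt_cuspFunction ModularForm.E₄ one_pos
    one_mem_strictPeriods_SL (by simpa using hq)).differentiableWithinAt

lemma j_eq_qj {z : ℂ} (hz : 0 < z.im) : j z = qj (nome z) / nome z := by
  have h := SlashInvariantFormClass.eq_cuspFunction ModularForm.E₄ ⟨z, hz⟩
    one_mem_strictPeriods_SL one_ne_zero
  simp only [qParam_one_eq_nome] at h
  rw [j_apply hz, qj, h, discriminant_eq hz, div_div, mul_comm (nome z)]

lemma qj_zero : qj 0 = 1 := by
  have h : UpperHalfPlane.cuspFunction 1 ModularForm.E₄ 0 = 1 := by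
    have := EisensteinSeries.E_qExpansion_coeff_zero (k := 4) (by norm_num) (by decide)
    simpa [UpperHalfPlane.qExpansion_coeff] using this
  simp [qj, h, eulerProd_zero]

/-- The holomorphic part `j - q⁻¹` as a function of `q`. -/
def jReg : ℂ → ℂ := dslope qj 0

lemma differentiableOn_jReg : DifferentiableOn ℂ jReg (Metric.ball 0 1) :=
  (differentiableOn_dslope (Metric.ball_mem_nhds 0 one_pos)).2 differentiableOn_qj

theorem j_eq_inv_add {z : ℂ} (hz : 0 < z.im) : j z = (nome z)⁻¹ + jReg (nome z) := by
  rw [j_eq_qj hz, jReg, dslope_of_ne _ (nome_ne_zero z), slope_def_field, qj_zero]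
  have := nome_ne_zero z
  field_simp
  ring

lemma hasDerivAt_nome (z : ℂ) : HasDerivAt nome (2 * π * I * nome z) z := by
  have := ((hasDerivAt_id z).const_mul (2 * π * I)).cexp
  refine this.congr_deriv ?_
  simp [nome, mul_comm]

lemma hasDerivAt_j {z : ℂ} (hz : 0 < z.im) :
    HasDerivAt j (-(2 * π * I) * (nome z)⁻¹ + 2 * π * I * (nome z * deriv jReg (nome z))) z := by
  have h1 := (hasDerivAt_nome z).inv (nome_ne_zero z)
  have hd : DifferentiableAt ℂ jReg (nome z) := differentiableOn_jReg.differentiableAt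
    (Metric.isOpen_ball.mem_nhds (by simpa using norm_nome_lt_one hz))
  have h2 := hd.hasDerivAt.comp z (hasDerivAt_nome z)
  have h3 := h1.add h2
  have hev : j =ᶠ[𝓝 z] (nome⁻¹ + jReg ∘ nome) := by
    filter_upwards [(isOpen_lt continuous_const continuous_im).mem_nhds hz] with w hw
    exact j_eq_inv_add hw
  refine (h3.congr_of_eventuallyEq hev).congr_deriv ?_
  have := nome_ne_zero z
  field_simp

lemma differentiableAt_j {z : ℂ} (hz : 0 < z.im) : DifferentiableAt ℂ j z :=
  (hasDerivAt_j hz).differentiableAt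

lemma differentiableOn_j : DifferentiableOn ℂ j {z | 0 < z.im} :=
  fun _ hz ↦ (differentiableAt_j hz).differentiableWithinAt

lemma isOpen_im_pos : IsOpen {z : ℂ | 0 < z.im} := isOpen_lt continuous_const continuous_im

lemma analyticAt_j {z : ℂ} (hz : 0 < z.im) : AnalyticAt ℂ j z :=
  differentiableOn_j.analyticAt (isOpen_im_pos.mem_nhds hz)

/-- The reflection symmetry of `j` passes to `jReg` off 0, and to 0 by continuity. Since the
constant term is real, the sign of `Im j` near `i∞` is governed by `q⁻¹`. -/
lemma jReg_conj_zero : (starRingEnd ℂ) (jReg 0) = jReg 0 := by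
  have hc : ContinuousAt jReg 0 := (differentiableOn_jReg.differentiableAt
    (Metric.ball_mem_nhds 0 one_pos)).continuousAt
  have hc' : ContinuousAt (fun q ↦ (starRingEnd ℂ) (jReg ((starRingEnd ℂ) q))) 0 := by
    refine continuous_conj.continuousAt.comp (ContinuousAt.comp ?_ continuous_conj.continuousAt)
    rwa [map_zero]
  have hev : (fun q ↦ (starRingEnd ℂ) (jReg ((starRingEnd ℂ) q))) =ᶠ[𝓝[≠] 0] jReg := by
    filter_upwards [self_mem_nhdsWithin, mem_nhdsWithin_of_mem_nhds
      (Metric.ball_mem_nhds (0 : ℂ) one_pos)] with q h0 hq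
    obtain ⟨z, hz, rfl⟩ := exists_nome_eq (by simpa using hq) h0
    have h1 := j_eq_inv_add hz
    have h2 := j_eq_inv_add (z := -(starRingEnd ℂ) z) (by simpa using hz)
    rw [nome_neg_conj, j_neg_conj hz, h1] at h2
    have h3 := congrArg (starRingEnd ℂ) h2
    simp only [map_add, map_inv₀, conj_conj] at h3
    exact (add_left_cancel h3).symm
  have t1 := hc'.tendsto.mono_left (nhdsWithin_le_nhds (s := {0}ᶜ))
  have t2 := (hc.tendsto.mono_left (nhdsWithin_le_nhds (s := {0}ᶜ))).congr' hev.symm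
  simpa using tendsto_nhds_unique t1 t2

/-! ### Quantitative bounds -/

lemma one_sub_sum_le_prod_one_sub {ι : Type*} (s : Finset ι) (f : ι → ℝ)
    (h0 : ∀ i ∈ s, 0 ≤ f i) (h1 : ∀ i ∈ s, f i ≤ 1) :
    1 - ∑ i ∈ s, f i ≤ ∏ i ∈ s, (1 - f i) := by
  classical
  induction s using Finset.induction_on with
  | empty => simp
  | insert a s ha ih =>
    have ih' := ih (fun i hi ↦ h0 i (Finset.mem_insert_of_mem hi))
      (fun i hi ↦ h1 i (Finset.mem_insert_of_mem hi))
    have hp : ∏ i ∈ s, (1 - f i) ≤ 1 := Finset.prod_le_one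
      (fun i hi ↦ sub_nonneg.2 (h1 i (Finset.mem_insert_of_mem hi)))
      (fun i hi ↦ by linarith [h0 i (Finset.mem_insert_of_mem hi)])
    rw [Finset.prod_insert ha, Finset.sum_insert ha]
    nlinarith [h0 a (Finset.mem_insert_self a s)]

lemma sum_pow_succ_le {r : ℝ} (h0 : 0 ≤ r) (h1 : r < 1) (s : Finset ℕ) :
    ∑ n ∈ s, r ^ (n + 1) ≤ r / (1 - r) := by
  have h := (hasSum_geometric_of_lt_one h0 h1).mul_left r
  simp_rw [← pow_succ'] at h
  exact sum_le_hasSum s (fun n _ ↦ by positivity) h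

lemma le_norm_eulerProd {q : ℂ} (hq : ‖q‖ < 1) : 1 - ‖q‖ / (1 - ‖q‖) ≤ ‖eulerProd q‖ := by
  have h := (ModularForm.multipliable_one_sub_pow hq).hasProd
  refine ge_of_tendsto h.norm (Eventually.of_forall fun s ↦ ?_)
  simp only
  calc 1 - ‖q‖ / (1 - ‖q‖) ≤ 1 - ∑ n ∈ s, ‖q‖ ^ (n + 1) := by
        linarith [sum_pow_succ_le (norm_nonneg q) hq s]
    _ ≤ ∏ n ∈ s, (1 - ‖q‖ ^ (n + 1)) := one_sub_sum_le_prod_one_sub s _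
        (fun _ _ ↦ by positivity) (fun _ _ ↦ pow_le_one₀ (norm_nonneg _) hq.le)
    _ ≤ _ := by
        refine Finset.prod_le_prod (fun _ _ ↦ sub_nonneg.2 (pow_le_one₀ (norm_nonneg _) hq.le))
          fun n _ ↦ ?_
        simpa using norm_sub_norm_le (1 : ℂ) (q ^ (n + 1))

lemma norm_eulerProd_le {q : ℂ} (hq : ‖q‖ < 1) :
    ‖eulerProd q‖ ≤ Real.exp (‖q‖ / (1 - ‖q‖)) := by
  have h := (ModularForm.multipliable_one_sub_pow hq).hasProd
  refine le_of_tendsto h.norm (Eventually.of_forall fun s ↦ ?_)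
  simp only
  calc ∏ n ∈ s, ‖1 - q ^ (n + 1)‖ ≤ ∏ n ∈ s, Real.exp (‖q‖ ^ (n + 1)) := by
        refine Finset.prod_le_prod (fun _ _ ↦ norm_nonneg _) fun n _ ↦ ?_
        have h1 := norm_sub_le (1 : ℂ) (q ^ (n + 1))
        have h2 := Real.add_one_le_exp (‖q‖ ^ (n + 1))
        rw [norm_one, norm_pow] at h1
        linarith
    _ = Real.exp (∑ n ∈ s, ‖q‖ ^ (n + 1)) := (Real.exp_sum _ _).symm
    _ ≤ _ := Real.exp_le_exp.2 (sum_pow_succ_le (norm_nonneg q) hq s)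

theorem norm_j_le {z : ℂ} (hz : 0 < z.im) (hq : ‖nome z‖ ≤ 1 / 80) :
    ‖j z‖ ≤ 150 * ‖nome z‖⁻¹ := by
  have hr := norm_nonneg (nome z)
  have hE : ‖1 + eisSeries (nome z)‖ ≤ 19 / 4 := by
    have h1 := norm_eisSeries_le (q := nome z) (by linarith)
    have h2 : 240 * ‖nome z‖ / (1 - 16 * ‖nome z‖) ≤ 15 / 4 := by
      rw [div_le_iff₀ (by linarith)]
      linarith
    have h3 := norm_add_le 1 (eisSeries (nome z))
    rw [norm_one] at h3
    linarith
  have hP : 78 / 79 ≤ ‖eulerProd (nome z)‖ := by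
    have h1 := le_norm_eulerProd (q := nome z) (by linarith)
    have h2 : ‖nome z‖ / (1 - ‖nome z‖) ≤ 1 / 79 := by
      rw [div_le_iff₀ (by linarith)]
      linarith
    linarith
  have hq0 : 0 < ‖nome z‖ := norm_pos_iff.2 (nome_ne_zero z)
  rw [j_eq hz, norm_div, norm_mul, norm_pow, norm_pow, div_le_iff₀ (by positivity)]
  calc ‖1 + eisSeries (nome z)‖ ^ 3 ≤ (19 / 4) ^ 3 := by gcongr
    _ ≤ 150 * (78 / 79) ^ 24 := by norm_num
    _ ≤ 150 * ‖eulerProd (nome z)‖ ^ 24 := by gcongr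
    _ = _ := by field_simp

theorem le_norm_j {z : ℂ} (hz : 0 < z.im) (hq : ‖nome z‖ ≤ 1 / 500) :
    ‖nome z‖⁻¹ / 10 ≤ ‖j z‖ := by
  have hr := norm_nonneg (nome z)
  have hE : 1 / 2 ≤ ‖1 + eisSeries (nome z)‖ := by
    have h1 := norm_eisSeries_le (q := nome z) (by linarith)
    have h2 : 240 * ‖nome z‖ / (1 - 16 * ‖nome z‖) ≤ 1 / 2 := by
      rw [div_le_iff₀ (by linarith)]
      linarith
    have h3 := norm_sub_norm_le 1 (-eisSeries (nome z))
    rw [norm_one, norm_neg, sub_neg_eq_add] at h3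
    linarith
  have hP : ‖eulerProd (nome z)‖ ^ 24 ≤ 5 / 4 := by
    have h1 := norm_eulerProd_le (q := nome z) (by linarith)
    have h2 : ‖nome z‖ / (1 - ‖nome z‖) ≤ 1 / 499 := by
      rw [div_le_iff₀ (by linarith)]
      linarith
    have h3 : Real.exp (1 / 499) ≤ 499 / 498 := by
      have := Real.exp_bound_div_one_sub_of_interval (x := 1 / 499) (by norm_num) (by norm_num)
      norm_num at this ⊢
      exact this
    calc ‖eulerProd (nome z)‖ ^ 24 ≤ (499 / 498) ^ 24 := by
          gcongr
          exact (h1.trans (Real.exp_le_exp.2 h2)).trans h3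
      _ ≤ _ := by norm_num
  have hq0 : 0 < ‖nome z‖ := norm_pos_iff.2 (nome_ne_zero z)
  have hP0 : 0 < ‖eulerProd (nome z)‖ := norm_pos_iff.2 (eulerProd_ne_zero hz)
  rw [j_eq hz, norm_div, norm_mul, norm_pow, norm_pow, le_div_iff₀ (by positivity)]
  calc ‖nome z‖⁻¹ / 10 * (‖nome z‖ * ‖eulerProd (nome z)‖ ^ 24)
      = ‖eulerProd (nome z)‖ ^ 24 / 10 := by field_simp
    _ ≤ (1 / 2) ^ 3 := by linarith
    _ ≤ _ := by gcongr

/-! ### The domain `F₊` -/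

/-- The interior of `F₊`, given by strict inequalities. -/
def Fint : Set ℂ := {z | 0 < z.re ∧ z.re < 1 / 2 ∧ 1 < ‖z‖ ∧ 0 < z.im}

lemma mem_Fplus {z : ℂ} : z ∈ Fplus ↔ 0 ≤ z.re ∧ z.re ≤ 1 / 2 ∧ 1 ≤ ‖z‖ ∧ 0 < z.im := by
  constructor
  · rintro ⟨⟨w, ⟨h1, -⟩, rfl⟩, h3, h4⟩
    refine ⟨h3, h4, ?_, w.im_pos⟩
    rw [normSq_eq_norm_sq] at h1
    exact (one_le_sq_iff₀ (norm_nonneg _)).1 h1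
  · rintro ⟨h1, h2, h3, h4⟩
    refine ⟨⟨⟨z, h4⟩, ⟨?_, ?_⟩, rfl⟩, h1, h2⟩
    · rw [normSq_eq_norm_sq]
      exact (one_le_sq_iff₀ (norm_nonneg _)).2 h3
    · exact abs_le.2 ⟨by simp only [UpperHalfPlane.re]; linarith, h2⟩

lemma im_pos_of_mem_Fplus {z : ℂ} (hz : z ∈ Fplus) : 0 < z.im := (mem_Fplus.1 hz).2.2.2

lemma one_le_norm_iff {z : ℂ} : 1 ≤ ‖z‖ ↔ 1 ≤ z.re ^ 2 + z.im ^ 2 := by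
  rw [← one_le_sq_iff₀ (norm_nonneg z), ← normSq_eq_norm_sq, normSq_apply, sq, sq]

lemma one_lt_norm_iff {z : ℂ} : 1 < ‖z‖ ↔ 1 < z.re ^ 2 + z.im ^ 2 := by
  rw [← one_lt_sq_iff₀ (norm_nonneg z), ← normSq_eq_norm_sq, normSq_apply, sq, sq]

lemma norm_eq_one_iff_sq {z : ℂ} : ‖z‖ = 1 ↔ z.re ^ 2 + z.im ^ 2 = 1 := by
  rw [← pow_eq_one_iff_of_nonneg (norm_nonneg z) two_ne_zero, ← normSq_eq_norm_sq,
    normSq_apply, sq, sq]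

lemma three_quarters_le_im_sq {z : ℂ} (hz : z ∈ Fplus) : 3 / 4 ≤ z.im ^ 2 := by
  obtain ⟨h1, h2, h3, -⟩ := mem_Fplus.1 hz
  rw [one_le_norm_iff] at h3
  nlinarith

/-- The open condition `0 < Im z` may be relaxed to `0 ≤ Im z`, since the other conditions exclude
real points. -/
lemma isClosed_Fplus : IsClosed Fplus := by
  have : Fplus = {z : ℂ | 0 ≤ z.re} ∩ {z | z.re ≤ 1 / 2} ∩ {z | 1 ≤ ‖z‖} ∩ {z | 0 ≤ z.im} := by
    ext z
    simp only [mem_Fplus, Set.mem_inter_iff, Set.mem_ofPred_eq]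
    constructor
    · rintro ⟨h1, h2, h3, h4⟩
      exact ⟨⟨⟨h1, h2⟩, h3⟩, h4.le⟩
    · rintro ⟨⟨⟨h1, h2⟩, h3⟩, h4⟩
      refine ⟨h1, h2, h3, lt_of_le_of_ne h4 fun h ↦ ?_⟩
      rw [one_le_norm_iff, ← h] at h3
      nlinarith
  rw [this]
  exact (((isClosed_le continuous_const continuous_re).inter
    (isClosed_le continuous_re continuous_const)).inter
    (isClosed_le continuous_const continuous_norm)).inter
    (isClosed_le continuous_const continuous_im)

lemma isOpen_Fint : IsOpen Fint :=
  (isOpen_lt continuous_const continuous_re).inter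
    ((isOpen_lt continuous_re continuous_const).inter
      ((isOpen_lt continuous_const continuous_norm).inter isOpen_im_pos))

lemma Fint_subset_Fplus : Fint ⊆ Fplus := fun _ ⟨h1, h2, h3, h4⟩ ↦
  mem_Fplus.2 ⟨h1.le, h2.le, h3.le, h4⟩

lemma Fplus_cases {z : ℂ} (hz : z ∈ Fplus) :
    z ∈ Fint ∨ z.re = 0 ∨ z.re = 1 / 2 ∨ ‖z‖ = 1 := by
  obtain ⟨h1, h2, h3, h4⟩ := mem_Fplus.1 hz
  rcases h1.eq_or_lt with h | h1
  · exact .inr (.inl h.symm)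
  rcases h2.eq_or_lt with h | h2
  · exact .inr (.inr (.inl h))
  rcases h3.eq_or_lt with h | h3
  · exact .inr (.inr (.inr h.symm))
  exact .inl ⟨h1, h2, h3, h4⟩

lemma interior_Fplus : interior Fplus = Fint := by
  refine subset_antisymm (fun z hz ↦ ?_) (interior_maximal Fint_subset_Fplus isOpen_Fint)
  have hmem := interior_subset hz
  have him := im_pos_of_mem_Fplus hmem
  have key (v : ℂ) : ∃ t : ℝ, 0 < t ∧ z + t * v ∈ Fplus := by
    have hc : ContinuousAt (fun t : ℝ ↦ z + t * v) 0 := by fun_prop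
    have h := hc.eventually (p := (· ∈ Fplus)) (by simpa using mem_interior_iff_mem_nhds.1 hz)
    have h' : ∀ᶠ t : ℝ in 𝓝[>] 0, z + t * v ∈ Fplus := h.filter_mono nhdsWithin_le_nhds
    obtain ⟨t, h1, h2⟩ := (h'.and self_mem_nhdsWithin).exists
    exact ⟨t, h2, h1⟩
  rcases Fplus_cases hmem with h | h | h | h
  · exact h
  · obtain ⟨t, ht, hm⟩ := key (-1)
    have := (mem_Fplus.1 hm).1
    simp [h] at this
    linarith
  · obtain ⟨t, ht, hm⟩ := key 1
    have := (mem_Fplus.1 hm).2.1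
    simp [h] at this
    linarith
  · obtain ⟨t, ht, hm⟩ := key (-I)
    -- Both remaining conditions are kept: `Im z > t` rules out having crossed the whole disc.
    have h3 := (mem_Fplus.1 hm).2.2
    rw [one_le_norm_iff] at h3
    rw [norm_eq_one_iff_sq] at h
    simp at h3
    nlinarith

lemma closure_subset_Fplus {V : Set ℂ} (hV : V ⊆ Fplus) : closure V ⊆ Fplus :=
  closure_minimal hV isClosed_Fplus

lemma isBounded_Fplus_inter (Y : ℝ) : Bornology.IsBounded (Fplus ∩ {z | z.im ≤ Y}) := by
  refine (Metric.isBounded_closedBall (x := (0 : ℂ)) (r := 1 + |Y|)).subset ?_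
  rintro z ⟨hz, hY⟩
  obtain ⟨h1, h2, -, h4⟩ := mem_Fplus.1 hz
  rw [mem_closedBall_zero_iff]
  refine (norm_le_abs_re_add_abs_im z).trans (add_le_add ?_ ?_)
  · rw [abs_of_nonneg h1]
    linarith
  · rw [abs_of_pos h4]
    exact (Set.mem_ofPred.1 hY).trans (le_abs_self Y)

lemma isCompact_Fplus_inter (Y : ℝ) : IsCompact (Fplus ∩ {z | z.im ≤ Y}) :=
  Metric.isCompact_of_isClosed_isBounded
    (isClosed_Fplus.inter (isClosed_le continuous_im continuous_const)) (isBounded_Fplus_inter Y)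

/-- Maximum principle for open subsets of `F₊`, with control at `i∞`. -/
theorem norm_le_of_boundary {V : Set ℂ} (hV : IsOpen V) (hVF : V ⊆ Fplus) {f : ℂ → ℂ}
    (hf : ∀ z ∈ closure V, DifferentiableAt ℂ f z) {C : ℝ}
    (hb : ∀ z ∈ closure V, z ∉ V → ‖f z‖ ≤ C)
    (htop : ∀ ε > 0, ∃ Y : ℝ, ∀ z ∈ V, Y ≤ z.im → ‖f z‖ ≤ C + ε) {z : ℂ} (hz : z ∈ V) :
    ‖f z‖ ≤ C := by
  refine le_of_forall_pos_le_add fun ε hε ↦ ?_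
  obtain ⟨Y, hY⟩ := htop ε hε
  -- Cutting `V` above `z` makes it bounded; the new edge lies at height at least `Y`, where the
  -- bound `C + ε` is available.
  set Y' := max Y (z.im + 1) with hY'
  set W : Set ℂ := {w | w.im < Y'} with hW
  have hbdd : Bornology.IsBounded (V ∩ W) := (isBounded_Fplus_inter Y').subset
    fun w hw ↦ ⟨hVF hw.1, (show w.im < Y' from hw.2).le⟩
  have hd : DiffContOnCl ℂ f (V ∩ W) := DifferentiableOn.diffContOnCl fun w hw ↦
    (hf w (closure_mono Set.inter_subset_left hw)).differentiableWithinAt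
  refine norm_le_of_forall_mem_frontier_norm_le hbdd hd (fun w hw ↦ ?_)
    (subset_closure ⟨hz, show z.im < Y' from lt_of_lt_of_le (by linarith) (le_max_right _ _)⟩)
  rcases frontier_inter_subset V W hw with h | h
  · have h2 := hV.frontier_eq ▸ h.1
    linarith [hb w h2.1 h2.2]
  · by_cases hwV : w ∈ V
    · refine hY w hwV ?_
      have h3 : w.im = Y' := by
        have := h.2
        rw [hW, frontier_setOfPred_im_lt] at this
        exact this
      rw [h3]
      exact le_max_left _ _
    · linarith [hb w h.1 hwV]

/-! ### Behaviour at `i∞` -/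

lemma tendsto_nome : Tendsto nome (comap im atTop) (𝓝 0) := by
  have h := Function.Periodic.qParam_tendsto one_pos
  have h' : Function.Periodic.qParam 1 = nome := funext qParam_one_eq_nome
  rw [h'] at h
  exact h.mono_right nhdsWithin_le_nhds

lemma eventually_comap_im {p : ℂ → Prop} (h : ∀ᶠ z in comap im atTop, p z) :
    ∃ Y : ℝ, ∀ z : ℂ, Y ≤ z.im → p z := by
  obtain ⟨Y, hY⟩ := eventually_atTop.1 (eventually_comap.1 h)
  exact ⟨Y, fun z hz ↦ hY _ hz z rfl⟩

lemma exists_im_jReg_le {ε : ℝ} (hε : 0 < ε) :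
    ∃ Y : ℝ, ∀ z : ℂ, Y ≤ z.im → (jReg (nome z)).im ≤ ε := by
  have hc : ContinuousAt jReg 0 := (differentiableOn_jReg.differentiableAt
    (Metric.ball_mem_nhds 0 one_pos)).continuousAt
  have him : (jReg 0).im = 0 := conj_eq_iff_im.1 jReg_conj_zero
  have ht : Tendsto (fun z ↦ (jReg (nome z)).im) (comap im atTop) (𝓝 0) := by
    rw [← him]
    exact (continuous_im.tendsto _).comp (hc.tendsto.comp tendsto_nome)
  exact eventually_comap_im ((ht.eventually (gt_mem_nhds hε)).mono fun _ h ↦ h.le)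

lemma exists_re_nome_mul_deriv_le {ε : ℝ} (hε : 0 < ε) :
    ∃ Y : ℝ, ∀ z : ℂ, Y ≤ z.im → (2 * π * I * (nome z * deriv jReg (nome z))).re ≤ ε := by
  have hc : ContinuousAt (deriv jReg) 0 := (differentiableOn_jReg.analyticAt
    (Metric.ball_mem_nhds 0 one_pos)).deriv.continuousAt
  have ht : Tendsto (fun z ↦ (2 * π * I * (nome z * deriv jReg (nome z))).re)
      (comap im atTop) (𝓝 0) := by
    have := (tendsto_nome.mul (hc.tendsto.comp tendsto_nome)).const_mul (2 * π * I)
    have h0 := (continuous_re.tendsto _).comp this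
    rwa [zero_mul, mul_zero, zero_re] at h0
  exact eventually_comap_im ((ht.eventually (gt_mem_nhds hε)).mono fun _ h ↦ h.le)

/-- The argument of `q⁻¹` is `-2π Re z`, which lies in `[-π, 0]`. -/
lemma nome_inv_im_nonpos {z : ℂ} (h0 : 0 ≤ z.re) (h1 : z.re ≤ 1 / 2) :
    ((nome z)⁻¹).im ≤ 0 := by
  rw [nome, ← exp_neg, exp_im]
  have h : (-(2 * π * I * z)).im = -(2 * π * z.re) := by simp
  rw [h, Real.sin_neg]
  have hs : 0 ≤ Real.sin (2 * π * z.re) := Real.sin_nonneg_of_nonneg_of_le_pi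
    (by have := Real.pi_pos; positivity) (by nlinarith [Real.pi_pos])
  have := mul_nonneg (Real.exp_pos (-(2 * π * I * z)).re).le hs
  linarith

theorem exists_le_norm_j (R : ℝ) : ∃ Y : ℝ, ∀ z : ℂ, Y ≤ z.im → R ≤ ‖j z‖ := by
  have h1 : Tendsto (fun z ↦ ‖nome z‖⁻¹) (comap im atTop) atTop := by
    refine (tendsto_norm_nhdsNE_zero.inv_tendsto_nhdsGT_zero).comp
      (tendsto_nhdsWithin_iff.2 ⟨tendsto_nome, .of_forall nome_ne_zero⟩)
  obtain ⟨Y, hY⟩ := eventually_comap_im (h1.eventually_ge_atTop (max 500 (10 * R)))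
  refine ⟨max Y 1, fun z hz ↦ ?_⟩
  have h2 := hY z ((le_max_left _ _).trans hz)
  have h3 : 0 < z.im := by linarith [le_max_right Y 1]
  have h4 := (le_max_left _ _).trans h2
  have h5 := (le_max_right _ _).trans h2
  have h6 := le_norm_j h3 (by
    rw [one_div]
    exact (le_inv_comm₀ (by norm_num) (norm_pos_iff.2 (nome_ne_zero z))).1 h4)
  linarith

/-! ### `j` is an open map -/

lemma isPreconnected_im_pos : IsPreconnected {z : ℂ | 0 < z.im} :=
  (convex_halfSpace_im_gt 0).isPreconnected

lemma j_not_const (w : ℂ) : ¬ ∀ z : ℂ, 0 < z.im → j z = w := by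
  intro h
  obtain ⟨Y, hY⟩ := exists_le_norm_j (‖w‖ + 1)
  have h1 := hY ((max Y 1 : ℝ) * I) (by simp)
  rw [h _ (by simp)] at h1
  linarith

lemma analyticOnNhd_j : AnalyticOnNhd ℂ j {z | 0 < z.im} := fun _ hz ↦ analyticAt_j hz

lemma isOpen_image_j {s : Set ℂ} (hs : IsOpen s) (h : ∀ z ∈ s, 0 < z.im) : IsOpen (j '' s) := by
  rcases analyticOnNhd_j.is_constant_or_isOpen isPreconnected_im_pos with ⟨w, hw⟩ | h'
  · exact (j_not_const w hw).elim
  · exact h' s h hs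

/-- The map `z ↦ -1/z` preserves `j`, fixes `i` and has derivative `-1` there, so `j'(i) = -j'(i)`.
-/
lemma deriv_j_I : deriv j I = 0 := by
  have h1 : HasDerivAt (fun z : ℂ ↦ -z⁻¹) (-1) I := by
    refine (hasDerivAt_inv I_ne_zero).neg.congr_deriv ?_
    simp
  have h2 : HasDerivAt j (deriv j I) (-I⁻¹) := by
    simpa using (differentiableAt_j (z := I) (by simp)).hasDerivAt
  have h3 := h2.comp I h1
  have h4 : j =ᶠ[𝓝 I] j ∘ fun z ↦ -z⁻¹ := by
    filter_upwards [isOpen_im_pos.mem_nhds (show 0 < I.im by simp)] with z hz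
    exact (j_neg_inv hz).symm
  have h5 := (h3.congr_of_eventuallyEq h4).deriv
  linear_combination h5 / 2

/-- Were `j'` constant, it would equal `j'(i) = 0` and `j` would be constant. -/
lemma isOpen_image_deriv_j {s : Set ℂ} (hs : IsOpen s) (h : ∀ z ∈ s, 0 < z.im) :
    IsOpen (deriv j '' s) := by
  have ha : AnalyticOnNhd ℂ (deriv j) {z | 0 < z.im} := analyticOnNhd_j.deriv
  rcases ha.is_constant_or_isOpen isPreconnected_im_pos with ⟨w, hw⟩ | h'
  · have hw0 : w = 0 := by rw [← hw I (by simp), deriv_j_I]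
    refine (j_not_const (j I) fun z hz ↦ ?_).elim
    exact isOpen_im_pos.is_const_of_deriv_eq_zero isPreconnected_im_pos differentiableOn_j
      (fun x hx ↦ by simp [hw x hx, hw0]) hz (by simp)
  · exact h' s h hs

/-! ### `j` on the boundary of `F₊` -/

lemma im_j_eq_zero_of_re_eq_zero {z : ℂ} (hz : 0 < z.im) (h : z.re = 0) : (j z).im = 0 := by
  have h1 : -(starRingEnd ℂ) z = z := by apply Complex.ext <;> simp [h]
  have h2 := j_neg_conj hz
  rw [h1] at h2
  exact conj_eq_iff_im.1 h2.symm

lemma im_j_eq_zero_of_re_eq_half {z : ℂ} (hz : 0 < z.im) (h : z.re = 1 / 2) : (j z).im = 0 := by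
  have h1 : -(starRingEnd ℂ) z + 1 = z := by
    apply Complex.ext
    · simp [h]; norm_num
    · simp
  have h2 := j_neg_conj hz
  rw [← j_add_one (by simpa using hz), h1] at h2
  exact conj_eq_iff_im.1 h2.symm

lemma im_j_eq_zero_of_norm_eq_one {z : ℂ} (hz : 0 < z.im) (h : ‖z‖ = 1) : (j z).im = 0 := by
  have h2 := j_neg_conj hz
  rw [← inv_eq_conj h, j_neg_inv hz] at h2
  exact conj_eq_iff_im.1 h2.symm

lemma im_j_eq_zero_of_notMem_Fint {z : ℂ} (hz : z ∈ Fplus) (h : z ∉ Fint) : (j z).im = 0 := by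
  have him := im_pos_of_mem_Fplus hz
  rcases Fplus_cases hz with h' | h' | h' | h'
  · exact (h h').elim
  · exact im_j_eq_zero_of_re_eq_zero him h'
  · exact im_j_eq_zero_of_re_eq_half him h'
  · exact im_j_eq_zero_of_norm_eq_one him h'

/-- The maximum principle for `exp(-ij)`, of modulus `exp(Im j)`: this is 1 on the boundary, and
near `i∞` at most `1 + ε` because `Im q⁻¹ ≤ 0`. -/
theorem im_j_nonpos {z : ℂ} (hz : z ∈ Fplus) : (j z).im ≤ 0 := by
  by_cases hzi : z ∈ Fint
  swap
  · exact (im_j_eq_zero_of_notMem_Fint hz hzi).le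
  have hn (w : ℂ) : ‖cexp (-(I * j w))‖ = Real.exp (j w).im := by simp [norm_exp]
  have h := norm_le_of_boundary isOpen_Fint Fint_subset_Fplus (f := fun w ↦ cexp (-(I * j w)))
    (C := 1) (fun w hw ↦ ?_) (fun w hw hw' ↦ ?_) (fun ε hε ↦ ?_) hzi
  · simpa [hn] using h
  · exact ((differentiableAt_j (im_pos_of_mem_Fplus
      (closure_subset_Fplus Fint_subset_Fplus hw))).const_mul I).neg.cexp
  · simp [hn, im_j_eq_zero_of_notMem_Fint (closure_subset_Fplus Fint_subset_Fplus hw) hw']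
  · obtain ⟨Y, hY⟩ := exists_im_jReg_le (Real.log_pos (by linarith : 1 < 1 + ε))
    refine ⟨Y, fun w hw hwY ↦ ?_⟩
    rw [hn, ← Real.le_log_iff_exp_le (by linarith), j_eq_inv_add hw.2.2.2, add_im]
    linarith [hY w hwY, nome_inv_im_nonpos hw.1.le hw.2.1.le]

theorem im_j_neg {z : ℂ} (hz : z ∈ Fint) : (j z).im < 0 := by
  have h : j '' Fint ⊆ interior {w | w.im ≤ 0} :=
    interior_maximal (by rintro _ ⟨w, hw, rfl⟩; exact im_j_nonpos (Fint_subset_Fplus hw))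
      (isOpen_image_j isOpen_Fint fun w hw ↦ hw.2.2.2)
  have := h ⟨z, hz, rfl⟩
  rwa [interior_setOfPred_im_le] at this

/-- The derivative of `j` along a curve which starts at a real value of `j` and stays in the closed
lower half plane. -/
lemma im_deriv_mul_nonpos {z v : ℂ} (hz : 0 < z.im) {γ : ℝ → ℂ} (hγ : HasDerivAt γ v 0)
    (h0 : γ 0 = z) (h : ∀ᶠ t in 𝓝[>] 0, (j (γ t)).im ≤ (j z).im) : (deriv j z * v).im ≤ 0 := by
  have h1 : HasDerivAt (fun t ↦ j (γ t)) (deriv j z * v) 0 :=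
    HasDerivAt.comp (h₂ := j) 0 (by rw [h0]; exact (differentiableAt_j hz).hasDerivAt) hγ
  have h2 : HasDerivAt (fun t ↦ (j (γ t)).im) (deriv j z * v).im 0 :=
    (imCLM.hasFDerivAt.comp_hasDerivAt 0 h1)
  have h3 := (hasDerivAt_iff_tendsto_slope.1 h2).mono_left
    (nhdsWithin_mono 0 (fun t (ht : 0 < t) ↦ ht.ne') : 𝓝[>] (0 : ℝ) ≤ _)
  refine le_of_tendsto h3 ?_
  filter_upwards [h, self_mem_nhdsWithin] with t ht htpos
  rw [slope_def_field, h0, sub_zero]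
  exact div_nonpos_of_nonpos_of_nonneg (by linarith) (le_of_lt htpos)

lemma im_deriv_mul_eq_zero {z v : ℂ} (hz : 0 < z.im) {γ : ℝ → ℂ} (hγ : HasDerivAt γ v 0)
    (h0 : γ 0 = z) (h : ∀ᶠ t in 𝓝 0, (j (γ t)).im = 0) : (deriv j z * v).im = 0 := by
  have hz0 : (j z).im = 0 := h0 ▸ h.self_of_nhds
  apply le_antisymm
  · refine im_deriv_mul_nonpos hz hγ h0 ?_
    filter_upwards [h.filter_mono nhdsWithin_le_nhds] with t ht
    rw [ht, hz0]
  · have hγ' : HasDerivAt (fun t ↦ γ (-t)) (-v) 0 := by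
      have h1 : HasDerivAt γ v (-0) := by simpa using hγ
      have := h1.scomp (0 : ℝ) (hasDerivAt_neg (0 : ℝ))
      simpa using! this
    have h1 := im_deriv_mul_nonpos hz hγ' (by simpa using h0) (by
      have hn : Tendsto (fun t : ℝ ↦ -t) (𝓝 0) (𝓝 0) := by
        simpa using (continuous_neg (G := ℝ)).tendsto 0
      filter_upwards [(hn.eventually h).filter_mono nhdsWithin_le_nhds] with t ht
      rw [ht, hz0])
    rw [mul_neg, neg_im] at h1
    linarith

lemma eventually_im_pos {z : ℂ} (hz : 0 < z.im) {γ : ℝ → ℂ} (hγ : ContinuousAt γ 0)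
    (h0 : γ 0 = z) : ∀ᶠ t in 𝓝 0, 0 < (γ t).im :=
  hγ.eventually (isOpen_im_pos.mem_nhds (by rw [h0]; exact hz))

lemma hasDerivAt_line (z v : ℂ) : HasDerivAt (fun t : ℝ ↦ z + t * v) v 0 := by
  simpa using ((ofRealCLM.hasDerivAt (x := (0 : ℝ))).mul_const v).const_add z

lemma re_deriv_eq_zero_of_re_eq_zero {z : ℂ} (hz : 0 < z.im) (h : z.re = 0) :
    (deriv j z).re = 0 := by
  have hd := hasDerivAt_line z I
  have := im_deriv_mul_eq_zero hz hd (by simp) (by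
    filter_upwards [eventually_im_pos hz hd.continuousAt (by simp)] with t ht
    exact im_j_eq_zero_of_re_eq_zero ht (by simp [h]))
  simpa using this

lemma re_deriv_eq_zero_of_re_eq_half {z : ℂ} (hz : 0 < z.im) (h : z.re = 1 / 2) :
    (deriv j z).re = 0 := by
  have hd := hasDerivAt_line z I
  have := im_deriv_mul_eq_zero hz hd (by simp) (by
    filter_upwards [eventually_im_pos hz hd.continuousAt (by simp)] with t ht
    exact im_j_eq_zero_of_re_eq_half ht (by simp [h]))
  simpa using this

lemma hasDerivAt_rotation (z : ℂ) : HasDerivAt (fun t : ℝ ↦ z * cexp (t * I)) (z * I) 0 := by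
  simpa using (((ofRealCLM.hasDerivAt (x := (0 : ℝ))).mul_const I).cexp.const_mul z)

lemma re_deriv_mul_eq_zero_of_norm_eq_one {z : ℂ} (hz : 0 < z.im) (h : ‖z‖ = 1) :
    (deriv j z * z).re = 0 := by
  have hd := hasDerivAt_rotation z
  have := im_deriv_mul_eq_zero hz hd (by simp) (by
    filter_upwards [eventually_im_pos hz hd.continuousAt (by simp)] with t ht
    exact im_j_eq_zero_of_norm_eq_one ht (by simp [h, norm_exp]))
  rw [← mul_assoc, mul_im, I_re, I_im] at this
  linarith

/-- If the ray from `z` in direction `v` initially stays in `F₊`. -/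
lemma im_deriv_mul_nonpos_of_ray {z v : ℂ} (hz : 0 < z.im) (h0 : (j z).im = 0)
    (h : ∀ᶠ t : ℝ in 𝓝[>] 0, z + t * v ∈ Fplus) : (deriv j z * v).im ≤ 0 :=
  im_deriv_mul_nonpos hz (hasDerivAt_line z v) (by simp)
    (h.mono fun t ht ↦ h0 ▸ im_j_nonpos ht)

/-! ### The sign of `Re j'` on `F₊` -/

lemma continuousAt_line (z v : ℂ) : ContinuousAt (fun t : ℝ ↦ z + t * v) 0 := by fun_prop

/-- An open condition at `z` persists along rays from `z`. -/
lemma eventually_ray {z : ℂ} {U : Set ℂ} (hU : IsOpen U) (hz : z ∈ U) (v : ℂ) :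
    ∀ᶠ t : ℝ in 𝓝[>] 0, z + t * v ∈ U :=
  ((continuousAt_line z v).eventually (hU.mem_nhds (by simpa using hz))).filter_mono
    nhdsWithin_le_nhds

lemma im_deriv_j_mul_arc {z : ℂ} (hz : 0 < z.im) (h0 : 0 ≤ z.re) (h2 : z.re < 1 / 2)
    (h : ‖z‖ = 1) : (deriv j z * z).im ≤ 0 := by
  refine im_deriv_mul_nonpos_of_ray (v := z) hz (im_j_eq_zero_of_norm_eq_one hz h) ?_
  filter_upwards [eventually_ray (isOpen_lt continuous_re continuous_const) h2 z,
    self_mem_nhdsWithin] with t ht1 ht2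
  have ht2' : 0 < t := ht2
  have e : z + t * z = ((1 + t : ℝ) : ℂ) * z := by push_cast; ring
  refine mem_Fplus.2 ⟨?_, le_of_lt ht1, ?_, ?_⟩
  · rw [e, re_ofReal_mul]; positivity
  · rw [e, norm_mul, h, mul_one, Complex.norm_real, Real.norm_of_nonneg (by linarith)]
    linarith
  · rw [e, im_ofReal_mul]; positivity

lemma re_deriv_j_nonpos_of_notMem_Fint {z : ℂ} (hz : z ∈ Fplus) (h : z ∉ Fint) :
    (deriv j z).re ≤ 0 := by
  obtain ⟨h1, h2, h3, him⟩ := mem_Fplus.1 hz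
  rcases h1.eq_or_lt with h1' | -
  · exact (re_deriv_eq_zero_of_re_eq_zero him h1'.symm).le
  rcases h2.eq_or_lt with h2' | h2'
  · exact (re_deriv_eq_zero_of_re_eq_half him h2').le
  rcases Fplus_cases hz with h' | h' | h' | h'
  · exact (h h').elim
  · exact (re_deriv_eq_zero_of_re_eq_zero him h').le
  · exact (re_deriv_eq_zero_of_re_eq_half him h').le
  have hre := re_deriv_mul_eq_zero_of_norm_eq_one him h'
  have hray := im_deriv_j_mul_arc him h1 h2' h'
  have hz1 : z * (starRingEnd ℂ) z = 1 := by rw [mul_conj', h']; simp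
  -- On the unit circle `z j'(z)` is a nonpositive multiple of `i`; multiplying by the conjugate of
  -- `z`, whose imaginary part is negative, gives `Re j' ≤ 0`.
  have e : deriv j z = (deriv j z * z) * (starRingEnd ℂ) z := by rw [mul_assoc, hz1, mul_one]
  rw [e, mul_re, hre, conj_re, conj_im]
  nlinarith [mul_nonneg (neg_nonneg.2 hray) him.le]

/-- The maximum principle for `exp(j')`. At `i∞` the main term `-2πi q⁻¹` has real part `2π Im q⁻¹ ≤
0`. -/
lemma re_deriv_j_nonpos {z : ℂ} (hz : z ∈ Fint) : (deriv j z).re ≤ 0 := by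
  have hn (w : ℂ) : ‖cexp (deriv j w)‖ = Real.exp (deriv j w).re := norm_exp _
  have h := norm_le_of_boundary isOpen_Fint Fint_subset_Fplus (f := fun w ↦ cexp (deriv j w))
    (C := 1) (fun w hw ↦ ?_) (fun w hw hw' ↦ ?_) (fun ε hε ↦ ?_) hz
  · simpa [hn] using h
  · exact (analyticAt_j (im_pos_of_mem_Fplus
      (closure_subset_Fplus Fint_subset_Fplus hw))).deriv.differentiableAt.cexp
  · rw [hn, Real.exp_le_one_iff]
    exact re_deriv_j_nonpos_of_notMem_Fint (closure_subset_Fplus Fint_subset_Fplus hw) hw'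
  · obtain ⟨Y, hY⟩ := exists_re_nome_mul_deriv_le (Real.log_pos (by linarith : 1 < 1 + ε))
    refine ⟨Y, fun w hw hwY ↦ ?_⟩
    rw [hn, ← Real.le_log_iff_exp_le (by linarith), (hasDerivAt_j hw.2.2.2).deriv, add_re]
    have h1 := hY w hwY
    have h2 : (-(2 * π * I) * (nome w)⁻¹).re = 2 * π * ((nome w)⁻¹).im := by
      simp [mul_re]
    have h3 := mul_nonneg (by positivity : 0 ≤ 2 * π)
      (neg_nonneg.2 (nome_inv_im_nonpos hw.1.le hw.2.1.le))
    linarith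

theorem re_deriv_j_neg {z : ℂ} (hz : z ∈ Fint) : (deriv j z).re < 0 := by
  have h : deriv j '' Fint ⊆ interior {w | w.re ≤ 0} :=
    interior_maximal (by rintro _ ⟨w, hw, rfl⟩; exact re_deriv_j_nonpos hw)
      (isOpen_image_deriv_j isOpen_Fint fun w hw ↦ hw.2.2.2)
  have := h ⟨z, hz, rfl⟩
  rwa [interior_setOfPred_re_le] at this

/-! ### Local behaviour at the boundary -/

/-- On a longer interval, `sin x` and `sin (x + π) = -sin x` would both be nonpositive for a range
of `x`, so sine would vanish at two points less than `π` apart. -/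
lemma sin_nonpos_Ioo_length_le {a b : ℝ} (h : ∀ x ∈ Set.Ioo a b, Real.sin x ≤ 0) :
    b - a ≤ π := by
  by_contra! hlt
  have hpi := Real.pi_pos
  have key (x : ℝ) (h1 : a < x) (h2 : x + π < b) : Real.sin x = 0 := by
    have e1 := h x ⟨h1, by linarith⟩
    have e2 := h (x + π) ⟨by linarith, h2⟩
    rw [Real.sin_add_pi] at e2
    linarith
  set d := min ((b - a - π) / 3) 1 with hd
  have hd0 : 0 < d := lt_min (by linarith) one_pos
  have hd1 : d ≤ (b - a - π) / 3 := min_le_left _ _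
  have hd2 : d < π := (min_le_right _ _).trans_lt (by linarith [Real.pi_gt_three])
  have s1 := key (a + d) (by linarith) (by linarith)
  have s2 := key (a + d + d) (by linarith) (by linarith)
  rw [Real.sin_add, s1, zero_mul, zero_add] at s2
  have hsd := Real.sin_pos_of_pos_of_lt_pi hd0 hd2
  have hc : Real.cos (a + d) = 0 := (mul_eq_zero.1 s2).resolve_right hsd.ne'
  have := Real.sin_sq_add_cos_sq (a + d)
  rw [s1, hc] at this
  norm_num at this

/-- The order of vanishing of a holomorphic function whose imaginary part is nonpositive on a
sector is bounded in terms of the opening of the sector. -/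
lemma order_mul_le_pi {f g : ℂ → ℂ} {z : ℂ} {n : ℕ} (hg : ContinuousAt g z) (hgz : g z ≠ 0)
    (hfg : ∀ᶠ w in 𝓝 z, f w = (w - z) ^ n * g w) {α β : ℝ}
    (h : ∀ φ ∈ Set.Ioo α β, ∀ᶠ t : ℝ in 𝓝[>] 0, (f (z + t * cexp (φ * I))).im ≤ 0) :
    n * (β - α) ≤ π := by
  -- Dividing `f` by `tⁿ` and letting `t → 0` on the ray of angle `φ` leaves the leading term, whose
  -- argument is `nφ + arg g(z)`.
  have key : ∀ φ ∈ Set.Ioo α β, Real.sin (n * φ + (g z).arg) ≤ 0 := by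
    intro φ hφ
    have ht : Tendsto (fun t : ℝ ↦ z + t * cexp (φ * I)) (𝓝[>] 0) (𝓝 z) := by
      have := (continuousAt_line z (cexp (φ * I))).tendsto
      simp only [ofReal_zero, zero_mul, add_zero] at this
      exact this.mono_left nhdsWithin_le_nhds
    have hlim : Tendsto (fun t : ℝ ↦ (cexp (φ * I) ^ n * g (z + t * cexp (φ * I))).im) (𝓝[>] 0)
        (𝓝 (cexp (φ * I) ^ n * g z).im) :=
      (continuous_im.tendsto _).comp ((hg.tendsto.comp ht).const_mul _)
    have hle : (cexp (φ * I) ^ n * g z).im ≤ 0 := by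
      refine le_of_tendsto hlim ?_
      filter_upwards [h φ hφ, ht.eventually hfg, self_mem_nhdsWithin] with t h1 h2 h3
      have h3' : 0 < t := h3
      rw [h2, add_sub_cancel_left, mul_pow, ← ofReal_pow, mul_assoc, im_ofReal_mul] at h1
      exact nonpos_of_mul_nonpos_right h1 (by positivity)
    have e : cexp (φ * I) ^ n * g z = ‖g z‖ * cexp ((n * φ + (g z).arg : ℝ) * I) := by
      conv_lhs => rw [← norm_mul_exp_arg_mul_I (g z)]
      rw [← exp_nat_mul]
      push_cast
      rw [add_mul, exp_add]
      ring_nf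
    rw [e, im_ofReal_mul, exp_ofReal_mul_I_im] at hle
    exact nonpos_of_mul_nonpos_right hle (norm_pos_iff.2 hgz)
  rcases Nat.eq_zero_or_pos n with rfl | hn
  · simpa using Real.pi_pos.le
  have hn' : (0 : ℝ) < n := by exact_mod_cast hn
  have := sin_nonpos_Ioo_length_le (a := n * α + (g z).arg) (b := n * β + (g z).arg) (by
    intro x hx
    have := key ((x - (g z).arg) / n) ⟨by rw [lt_div_iff₀ hn']; linarith [hx.1],
      by rw [div_lt_iff₀ hn']; linarith [hx.2]⟩
    rwa [mul_div_cancel₀ _ hn'.ne', sub_add_cancel] at this)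
  linarith

lemma exists_j_sub_eq_pow_mul {z : ℂ} (hz : 0 < z.im) : ∃ (n : ℕ) (g : ℂ → ℂ),
    AnalyticAt ℂ g z ∧ g z ≠ 0 ∧ ∀ᶠ w in 𝓝 z, j w - j z = (w - z) ^ n * g w := by
  have ha : AnalyticAt ℂ (fun w ↦ j w - j z) z := (analyticAt_j hz).sub analyticAt_const
  refine ha.exists_eventuallyEq_pow_smul_nonzero_iff.2 fun h ↦ j_not_const (j z) fun w hw ↦ ?_
  refine analyticOnNhd_j.eqOn_of_preconnected_of_eventuallyEq analyticOnNhd_const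
    isPreconnected_im_pos hz ?_ hw
  filter_upwards [h] with w hw
  exact sub_eq_zero.1 hw

/-- Local expansion of `j` at a point of `F₊` with a sector contained in `F₊`. -/
lemma exists_order_of_sector {z : ℂ} (hz : 0 < z.im) (h0 : (j z).im = 0) {α β : ℝ}
    (h : ∀ φ ∈ Set.Ioo α β, ∀ᶠ t : ℝ in 𝓝[>] 0, z + t * cexp (φ * I) ∈ Fplus) :
    ∃ (n : ℕ) (g : ℂ → ℂ), AnalyticAt ℂ g z ∧ g z ≠ 0 ∧ n ≠ 0 ∧ n * (β - α) ≤ π ∧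
      ∀ᶠ w in 𝓝 z, j w = (w - z) ^ n * g w + j z := by
  obtain ⟨n, g, hg, hgz, hfg⟩ := exists_j_sub_eq_pow_mul hz
  refine ⟨n, g, hg, hgz, ?_, order_mul_le_pi hg.continuousAt hgz hfg fun φ hφ ↦ ?_,
    hfg.mono fun w hw ↦ by rw [← hw]; ring⟩
  · rintro rfl
    have := hfg.self_of_nhds
    simp [eq_comm, hgz] at this
  · filter_upwards [h φ hφ] with t ht
    rw [sub_im, h0, sub_zero]
    exact im_j_nonpos ht

/-- A sector of opening `π` forces order 1, and then `j'(z)` is the leading coefficient. This serves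
all boundary points other than the corners `i` and `ζ`. -/
lemma deriv_j_ne_zero_of_half_disc {z : ℂ} (hz : 0 < z.im) (h0 : (j z).im = 0) {α : ℝ}
    (h : ∀ φ ∈ Set.Ioo α (α + π), ∀ᶠ t : ℝ in 𝓝[>] 0, z + t * cexp (φ * I) ∈ Fplus) :
    deriv j z ≠ 0 := by
  obtain ⟨n, g, hg, hgz, hn0, hn, hfg⟩ := exists_order_of_sector hz h0 h
  have hn1 : n = 1 := by
    have : (n : ℝ) ≤ 1 := by nlinarith [Real.pi_pos]
    have : n ≤ 1 := by exact_mod_cast this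
    omega
  subst hn1
  have hd := (((hasDerivAt_id z).sub_const z).mul hg.differentiableAt.hasDerivAt).add_const (j z)
  have hd' := hd.congr_of_eventuallyEq (f₁ := j) (hfg.mono fun w hw ↦ by
    rw [hw, pow_one]
    rfl)
  rw [hd'.deriv]
  simpa using hgz

lemma cos_pos_of_mem_shift {θ φ : ℝ} (h : φ ∈ Set.Ioo (θ - π / 2) (θ - π / 2 + π)) :
    0 < Real.cos (φ - θ) :=
  Real.cos_pos_of_mem_Ioo ⟨by linarith [h.1], by linarith [h.2]⟩

theorem deriv_j_ne_zero_left {z : ℂ} (hz : z ∈ Fplus) (h0 : z.re = 0) (h : 1 < ‖z‖) :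
    deriv j z ≠ 0 := by
  have him := im_pos_of_mem_Fplus hz
  refine deriv_j_ne_zero_of_half_disc him (im_j_eq_zero_of_re_eq_zero him h0) (α := 0 - π / 2)
    fun φ hφ ↦ ?_
  have hc := cos_pos_of_mem_shift hφ
  rw [sub_zero] at hc
  filter_upwards [eventually_ray (isOpen_lt continuous_re continuous_const)
    (show z.re < 1 / 2 by rw [h0]; norm_num) (cexp (φ * I)),
    eventually_ray (isOpen_lt continuous_const continuous_norm) h (cexp (φ * I)),
    eventually_ray isOpen_im_pos him (cexp (φ * I)), self_mem_nhdsWithin] with t h1 h2 h3 h4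
  have h4' : 0 < t := h4
  refine mem_Fplus.2 ⟨?_, le_of_lt (Set.mem_ofPred.1 h1), le_of_lt (Set.mem_ofPred.1 h2), h3⟩
  rw [add_re, re_ofReal_mul, exp_ofReal_mul_I_re, h0]
  positivity

theorem deriv_j_ne_zero_right {z : ℂ} (hz : z ∈ Fplus) (h0 : z.re = 1 / 2) (h : 1 < ‖z‖) :
    deriv j z ≠ 0 := by
  have him := im_pos_of_mem_Fplus hz
  refine deriv_j_ne_zero_of_half_disc him (im_j_eq_zero_of_re_eq_half him h0) (α := π - π / 2)
    fun φ hφ ↦ ?_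
  have hc := cos_pos_of_mem_shift hφ
  rw [Real.cos_sub_pi] at hc
  filter_upwards [eventually_ray (isOpen_lt continuous_const continuous_re)
    (show 0 < z.re by rw [h0]; norm_num) (cexp (φ * I)),
    eventually_ray (isOpen_lt continuous_const continuous_norm) h (cexp (φ * I)),
    eventually_ray isOpen_im_pos him (cexp (φ * I)), self_mem_nhdsWithin] with t h1 h2 h3 h4
  have h4' : 0 < t := h4
  refine mem_Fplus.2 ⟨le_of_lt (Set.mem_ofPred.1 h1), ?_, le_of_lt (Set.mem_ofPred.1 h2), h3⟩
  rw [add_re, re_ofReal_mul, exp_ofReal_mul_I_re, h0]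
  nlinarith

lemma eq_exp_arg {z : ℂ} (h : ‖z‖ = 1) : z = cexp (z.arg * I) := by
  have := norm_mul_exp_arg_mul_I z
  rw [h] at this
  simpa using this.symm

/-- Moving from a point of the unit circle to the outer side of the tangent leaves the disc. -/
lemma one_le_norm_add_mul_exp {θ φ t : ℝ} (ht : 0 ≤ t) (hc : 0 ≤ Real.cos (φ - θ)) :
    1 ≤ ‖cexp (θ * I) + t * cexp (φ * I)‖ := by
  rw [one_le_norm_iff, add_re, add_im, re_ofReal_mul, im_ofReal_mul, exp_ofReal_mul_I_re,
    exp_ofReal_mul_I_re, exp_ofReal_mul_I_im, exp_ofReal_mul_I_im]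
  rw [Real.cos_sub] at hc
  nlinarith [Real.sin_sq_add_cos_sq θ, mul_nonneg ht hc, sq_nonneg (t * Real.cos φ),
    sq_nonneg (t * Real.sin φ)]

theorem deriv_j_ne_zero_arc {z : ℂ} (hz : 0 < z.im) (h0 : 0 < z.re) (h2 : z.re < 1 / 2)
    (h : ‖z‖ = 1) : deriv j z ≠ 0 := by
  refine deriv_j_ne_zero_of_half_disc hz (im_j_eq_zero_of_norm_eq_one hz h)
    (α := z.arg - π / 2) fun φ hφ ↦ ?_
  have hc := cos_pos_of_mem_shift hφ
  filter_upwards [eventually_ray (isOpen_lt continuous_const continuous_re) h0 (cexp (φ * I)),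
    eventually_ray (isOpen_lt continuous_re continuous_const) h2 (cexp (φ * I)),
    eventually_ray isOpen_im_pos hz (cexp (φ * I)), self_mem_nhdsWithin] with t h1 h2 h3 h4
  have h4' : 0 < t := h4
  refine mem_Fplus.2 ⟨le_of_lt (Set.mem_ofPred.1 h1), le_of_lt (Set.mem_ofPred.1 h2), ?_, h3⟩
  have := one_le_norm_add_mul_exp (θ := z.arg) h4'.le hc.le
  rwa [← eq_exp_arg h] at this

/-- The local expansion of `j` at `i`, a double point. -/
theorem exists_expansion_j_I : ∃ g : ℂ → ℂ, ContinuousAt g I ∧ g I ≠ 0 ∧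
    (∀ᶠ w in 𝓝 I, j w = (w - I) ^ 2 * g w + j I) ∧ iteratedDeriv 2 j I = 2 * g I := by
  have hI : 0 < I.im := by simp
  obtain ⟨n, g, hg, hgz, hn0, hn, hfg⟩ := exists_order_of_sector (z := I) hI
    (im_j_eq_zero_of_re_eq_zero hI (by simp)) (α := 0) (β := π / 2) (fun φ hφ ↦ by
      have hc : 0 < Real.cos φ := Real.cos_pos_of_mem_Ioo ⟨by linarith [hφ.1, hφ.2], hφ.2⟩
      have hs : 0 < Real.sin φ := Real.sin_pos_of_pos_of_lt_pi hφ.1 (by linarith [hφ.1, hφ.2])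
      filter_upwards [eventually_ray (isOpen_lt continuous_re continuous_const)
        (show I.re < 1 / 2 by simp) (cexp (φ * I)), self_mem_nhdsWithin] with t h1 h4
      have h4' : 0 < t := h4
      refine mem_Fplus.2 ⟨?_, le_of_lt (Set.mem_ofPred.1 h1), ?_, ?_⟩
      · rw [add_re, re_ofReal_mul, exp_ofReal_mul_I_re, I_re]
        positivity
      · have e : I = cexp ((π / 2 : ℝ) * I) := by
          push_cast
          exact exp_pi_div_two_mul_I.symm
        have := one_le_norm_add_mul_exp (θ := π / 2) (φ := φ) h4'.le
          (by rw [Real.cos_sub_pi_div_two]; exact hs.le)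
        rwa [← e] at this
      · rw [add_im, im_ofReal_mul, exp_ofReal_mul_I_im, I_im]
        positivity)
  -- At `i` only a quarter disc is available, so the order may be 2; order 1 is excluded by `j'(i) =
  -- 0`.
  have hn2 : n ≤ 2 := by
    have : (n : ℝ) ≤ 2 := by nlinarith [Real.pi_pos]
    exact_mod_cast this
  have hd1 (w : ℂ) (hw : DifferentiableAt ℂ g w) : HasDerivAt (fun w ↦ (w - I) ^ n * g w + j I)
      (n * (w - I) ^ (n - 1) * g w + (w - I) ^ n * deriv g w) w := by
    have := ((((hasDerivAt_id w).sub_const I).pow n).mul hw.hasDerivAt).add_const (j I)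
    simpa using! this
  have hn1 : n ≠ 1 := by
    rintro rfl
    have := ((hd1 I hg.differentiableAt).congr_of_eventuallyEq hfg).deriv
    rw [deriv_j_I] at this
    simp at this
    exact hgz this.symm
  obtain rfl : n = 2 := by omega
  have hderiv : deriv j =ᶠ[𝓝 I] fun w ↦ 2 * ((w - I) * g w) + (w - I) ^ 2 * deriv g w := by
    filter_upwards [hfg.eventually_nhds, hg.eventually_analyticAt] with w h1 h2
    rw [((hd1 w h2.differentiableAt).congr_of_eventuallyEq h1).deriv]
    push_cast
    ring
  have hd2 : HasDerivAt (fun w ↦ 2 * ((w - I) * g w) + (w - I) ^ 2 * deriv g w) (2 * g I) I := by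
    have h1 := (((hasDerivAt_id I).sub_const I).mul hg.differentiableAt.hasDerivAt).const_mul 2
    have h2 := (((hasDerivAt_id I).sub_const I).pow 2).mul hg.deriv.differentiableAt.hasDerivAt
    have h3 := h1.add h2
    simpa using! h3
  refine ⟨g, hg.continuousAt, hgz, hfg, ?_⟩
  rw [iteratedDeriv_succ, iteratedDeriv_one, (hd2.congr_of_eventuallyEq hderiv).deriv]

theorem iteratedDeriv_two_j_I_ne_zero : iteratedDeriv 2 j I ≠ 0 := by
  obtain ⟨g, -, hg, -, h⟩ := exists_expansion_j_I
  rw [h]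
  exact mul_ne_zero two_ne_zero hg

theorem zeta_eq : zeta = 1 / 2 + (√3 / 2 : ℝ) * I := by
  have : 2 * (π : ℂ) * I / 6 = ((π / 3 : ℝ) : ℂ) * I := by push_cast; ring
  rw [zeta, this, exp_mul_I, ← ofReal_cos, ← ofReal_sin, Real.cos_pi_div_three,
    Real.sin_pi_div_three]
  push_cast
  ring

lemma eq_zeta_of_re_eq_half {z : ℂ} (hz : 0 < z.im) (h : z.re = 1 / 2) (h1 : ‖z‖ = 1) :
    z = zeta := by
  rw [norm_eq_one_iff_sq, h] at h1
  have h2 : z.im = √3 / 2 := by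
    have h3 : z.im ^ 2 = (√3 / 2) ^ 2 := by rw [div_pow, Real.sq_sqrt (by norm_num)]; linarith
    exact (pow_left_inj₀ hz.le (by positivity) two_ne_zero).1 h3
  rw [zeta_eq]
  apply Complex.ext <;> simp [h, h2]

lemma eq_I_of_re_eq_zero {z : ℂ} (hz : 0 < z.im) (h : z.re = 0) (h1 : ‖z‖ = 1) : z = I := by
  rw [norm_eq_one_iff_sq, h] at h1
  have h2 : z.im = 1 := by nlinarith
  apply Complex.ext <;> simp [h, h2]

theorem deriv_j_ne_zero {z : ℂ} (hz : z ∈ Fplus) (hi : z ≠ I) (hζ : z ≠ zeta) :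
    deriv j z ≠ 0 := by
  have him := im_pos_of_mem_Fplus hz
  obtain ⟨h1, h2, h3, -⟩ := mem_Fplus.1 hz
  rcases h3.eq_or_lt with h3 | h3
  · rcases h1.eq_or_lt with h1 | h1
    · exact (hi (eq_I_of_re_eq_zero him h1.symm h3.symm)).elim
    rcases h2.eq_or_lt with h2 | h2
    · exact (hζ (eq_zeta_of_re_eq_half him h2 h3.symm)).elim
    exact deriv_j_ne_zero_arc him h1 h2 h3.symm
  · rcases h1.eq_or_lt with h1 | h1
    · exact deriv_j_ne_zero_left hz h1.symm h3
    rcases h2.eq_or_lt with h2 | h2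
    · exact deriv_j_ne_zero_right hz h2 h3
    intro h
    have := re_deriv_j_neg ⟨h1, h2, h3, him⟩
    simp [h] at this

/-! ### Injectivity of `j` inside `F₊` -/

/-- The Noshiro–Warschawski argument: on the segment from `a` to `b`, the function `Re (j/(b - a))`
has derivative `Re j' < 0`. -/
lemma injOn_j_of_convex {S : Set ℂ} (hS : Convex ℝ S) (hSF : S ⊆ Fint) : Set.InjOn j S := by
  intro a ha b hb hab
  by_contra hne
  have hba : b - a ≠ 0 := sub_ne_zero.2 (Ne.symm hne)
  have hmem (t : ℝ) (ht : t ∈ Set.Icc (0 : ℝ) 1) : a + t * (b - a) ∈ Fint := by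
    have := hS.add_smul_sub_mem ha hb ht
    exact hSF (by simpa using this)
  have hd (t : ℝ) (ht : t ∈ Set.Icc (0 : ℝ) 1) :
      HasDerivAt (fun t : ℝ ↦ (j (a + t * (b - a)) / (b - a)).re)
        (deriv j (a + t * (b - a))).re t := by
    have h1 : HasDerivAt (fun t : ℝ ↦ a + t * (b - a)) (b - a) t := by
      simpa using ((ofRealCLM.hasDerivAt (x := t)).mul_const (b - a)).const_add a
    have h2 := ((differentiableAt_j (hmem t ht).2.2.2).hasDerivAt.comp t h1).div_const (b - a)
    rw [mul_div_cancel_right₀ _ hba] at h2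
    exact reCLM.hasFDerivAt.comp_hasDerivAt t h2
  have hanti : StrictAntiOn (fun t : ℝ ↦ (j (a + t * (b - a)) / (b - a)).re) (Set.Icc 0 1) := by
    refine strictAntiOn_of_deriv_neg (convex_Icc 0 1)
      (fun t ht ↦ (hd t ht).continuousAt.continuousWithinAt) fun t ht ↦ ?_
    have ht' := interior_subset ht
    rw [(hd t ht').deriv]
    exact re_deriv_j_neg (hmem t ht')
  have := hanti (Set.left_mem_Icc.2 zero_le_one) (Set.right_mem_Icc.2 zero_le_one) one_pos
  simp [hab] at this

lemma mem_Fint_of_im_j_neg {z : ℂ} (hz : z ∈ Fplus) (h : (j z).im < 0) : z ∈ Fint := by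
  by_contra h'
  linarith [im_j_eq_zero_of_notMem_Fint hz h']

/-- The values which `j` takes at least twice inside `F₊`. -/
def multipleValues : Set ℂ := {w | ∃ a ∈ Fint, ∃ b ∈ Fint, a ≠ b ∧ j a = w ∧ j b = w}

lemma isOpen_multipleValues : IsOpen multipleValues := by
  rw [isOpen_iff_mem_nhds]
  rintro w ⟨a, ha, b, hb, hab, rfl, hb'⟩
  obtain ⟨U, V, hU, hV, haU, hbV, hUV⟩ := t2_separation hab
  have h1 := (isOpen_image_j (hU.inter isOpen_Fint) fun z hz ↦ hz.2.2.2.2).mem_nhds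
    ⟨a, ⟨haU, ha⟩, rfl⟩
  have h2 := (isOpen_image_j (hV.inter isOpen_Fint) fun z hz ↦ hz.2.2.2.2).mem_nhds
    ⟨b, ⟨hbV, hb⟩, hb'⟩
  filter_upwards [h1, h2]
  rintro w ⟨x, hx, rfl⟩ ⟨y, hy, hxy⟩
  exact ⟨x, hx.2, y, hy.2, fun h ↦ Set.disjoint_left.1 hUV hx.1 (h ▸ hy.1), rfl, hxy⟩

/-- Preimages of a convergent sequence stay in a compact part of `F₊`, as `|j| → ∞` at `i∞`. Limits
of the two preimages are interior since the value is not real, and local injectivity keeps them from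
merging. -/
lemma closure_multipleValues_inter_subset :
    closure multipleValues ∩ {w | w.im < 0} ⊆ multipleValues := by
  rintro w ⟨hw, hwim⟩
  obtain ⟨u, hu, hlim⟩ := mem_closure_iff_seq_limit.1 hw
  choose a ha b hb hab hja hjb using hu
  obtain ⟨R, hR⟩ := (Metric.isBounded_range_of_tendsto u hlim).exists_norm_le
  obtain ⟨Y, hY⟩ := exists_le_norm_j (R + 1)
  have hK {z : ℂ} (hz : z ∈ Fint) {n : ℕ} (h : j z = u n) : z ∈ Fplus ∩ {z | z.im ≤ Y} := by
    refine ⟨Fint_subset_Fplus hz, ?_⟩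
    by_contra! hlt
    have h1 := hY z (le_of_lt (not_le.1 hlt))
    have h2 := hR _ (Set.mem_range_self n)
    rw [h] at h1
    linarith
  have hcompact := (isCompact_Fplus_inter Y).prod (isCompact_Fplus_inter Y)
  obtain ⟨⟨x, y⟩, ⟨hx, hy⟩, φ, hφ, hφlim⟩ := hcompact.tendsto_subseq (x := fun n ↦ (a n, b n))
    fun n ↦ ⟨hK (ha n) (hja n), hK (hb n) (hjb n)⟩
  have hax : Tendsto (a ∘ φ) atTop (𝓝 x) := (continuous_fst.tendsto _).comp hφlim
  have hby : Tendsto (b ∘ φ) atTop (𝓝 y) := (continuous_snd.tendsto _).comp hφlim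
  have hjx : j x = w := by
    refine tendsto_nhds_unique (((differentiableAt_j
      (im_pos_of_mem_Fplus hx.1)).continuousAt.tendsto.comp hax).congr fun n ↦ ?_)
      (hlim.comp hφ.tendsto_atTop)
    exact hja (φ n)
  have hjy : j y = w := by
    refine tendsto_nhds_unique (((differentiableAt_j
      (im_pos_of_mem_Fplus hy.1)).continuousAt.tendsto.comp hby).congr fun n ↦ ?_)
      (hlim.comp hφ.tendsto_atTop)
    exact hjb (φ n)
  have hxF : x ∈ Fint := mem_Fint_of_im_j_neg hx.1 (by rw [hjx]; exact hwim)
  have hyF : y ∈ Fint := mem_Fint_of_im_j_neg hy.1 (by rw [hjy]; exact hwim)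
  refine ⟨x, hxF, y, hyF, ?_, hjx, hjy⟩
  rintro rfl
  obtain ⟨r, hr, hball⟩ := Metric.isOpen_iff.1 isOpen_Fint x hxF
  have hinj := injOn_j_of_convex (convex_ball x r) hball
  obtain ⟨n, h1, h2⟩ := ((hax.eventually (Metric.ball_mem_nhds x hr)).and
    (hby.eventually (Metric.ball_mem_nhds x hr))).exists
  exact hab (φ n) (hinj h1 h2 ((hja _).trans (hjb _).symm))

/-- Otherwise the set, open and relatively closed, would fill the lower half-plane. But a value far
down the imaginary axis is attained only above height 1, where the interior of `F₊` is a convex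
half-strip and `j` is injective. -/
theorem multipleValues_eq_empty : multipleValues = ∅ := by
  rw [Set.eq_empty_iff_forall_notMem]
  rintro w hw
  have hwim : w.im < 0 := by
    obtain ⟨a, ha, -, -, -, rfl, -⟩ := hw
    exact im_j_neg ha
  have hsub : {w : ℂ | w.im < 0} ⊆ multipleValues :=
    (convex_halfSpace_im_lt 0).isPreconnected.subset_of_closure_inter_subset
      isOpen_multipleValues ⟨w, hwim, hw⟩ closure_multipleValues_inter_subset
  obtain ⟨R, hR⟩ := (isCompact_Fplus_inter 1).exists_bound_of_continuousOn (f := j)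
    fun z hz ↦ (differentiableAt_j (im_pos_of_mem_Fplus hz.1)).continuousAt.continuousWithinAt
  obtain ⟨a, ha, b, hb, hab, hja, hjb⟩ := hsub
    (show (-((|R| + 1 : ℝ) * I)).im < 0 by
      rw [neg_im, im_ofReal_mul, I_im, mul_one]
      linarith [abs_nonneg R])
  have key {z : ℂ} (hz : z ∈ Fint) (h : j z = -((|R| + 1 : ℝ) * I)) : 1 < z.im := by
    by_contra! hle
    have := hR z ⟨Fint_subset_Fplus hz, hle⟩
    rw [h, norm_neg, norm_mul, norm_I, mul_one, Complex.norm_real,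
      Real.norm_of_nonneg (by positivity)] at this
    linarith [le_abs_self R]
  set T : Set ℂ := ({z | 0 < z.re} ∩ {z | z.re < 1 / 2}) ∩ {z | 1 < z.im} with hT
  have hTc : Convex ℝ T := ((convex_halfSpace_re_gt 0).inter (convex_halfSpace_re_lt _)).inter
    (convex_halfSpace_im_gt 1)
  have hTF : T ⊆ Fint := by
    rintro z ⟨⟨h1, h2⟩, h3⟩
    have h3' : 1 < z.im := h3
    refine ⟨h1, h2, ?_, by linarith⟩
    rw [one_lt_norm_iff]
    nlinarith [sq_nonneg z.re]
  exact hab (injOn_j_of_convex hTc hTF ⟨⟨ha.1, ha.2.1⟩, key ha hja⟩ ⟨⟨hb.1, hb.2.1⟩, key hb hjb⟩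
    (hja.trans hjb.symm))

theorem injOn_j_Fint : Set.InjOn j Fint := by
  intro a ha b hb hab
  by_contra hne
  have : j b ∈ multipleValues := ⟨a, ha, b, hb, hne, hab, rfl⟩
  simp [multipleValues_eq_empty] at this

/-! ### Monotonicity of `j` along the boundary of `F₊` -/

/-- The boundary of `F₊`, traversed from `1/2 + i∞` through `ζ` and `i` to `i∞`. -/
def bdryPath (s : ℝ) : ℂ :=
  if s ≤ π / 3 then zeta + ((π / 3 - s : ℝ) : ℂ) * I
  else if s ≤ π / 2 then cexp (s * I) else ((1 + (s - π / 2) : ℝ) : ℂ) * I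

lemma zeta_eq_exp : zeta = cexp ((π / 3 : ℝ) * I) := by
  rw [zeta]
  congr 1
  push_cast
  ring

lemma continuous_bdryPath : Continuous bdryPath := by
  unfold bdryPath
  refine Continuous.if_le (by fun_prop) (Continuous.if_le (by fun_prop) (by fun_prop)
    continuous_id continuous_const ?_) continuous_id continuous_const ?_
  · rintro s rfl
    simp only [sub_self, add_zero, ofReal_one, one_mul]
    push_cast
    exact exp_pi_div_two_mul_I
  · rintro s rfl
    rw [if_pos (by linarith [Real.pi_pos])]
    simp [zeta_eq_exp]

lemma zeta_re : zeta.re = 1 / 2 := by simp [zeta_eq]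

lemma zeta_im : zeta.im = √3 / 2 := by simp [zeta_eq]

lemma bdryPath_right {s : ℝ} (h : s ≤ π / 3) : bdryPath s = zeta + ((π / 3 - s : ℝ) : ℂ) * I :=
  if_pos h

lemma bdryPath_arc {s : ℝ} (h1 : π / 3 ≤ s) (h2 : s ≤ π / 2) : bdryPath s = cexp (s * I) := by
  rcases h1.eq_or_lt with rfl | h1
  · rw [bdryPath_right le_rfl, zeta_eq_exp]
    simp
  · rw [bdryPath, if_neg (not_le.2 h1), if_pos h2]

lemma bdryPath_left {s : ℝ} (h : π / 2 ≤ s) : bdryPath s = ((1 + (s - π / 2) : ℝ) : ℂ) * I := by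
  have h0 : ¬ s ≤ π / 3 := not_le.2 (by linarith [Real.pi_pos])
  rcases h.eq_or_lt with rfl | h
  · rw [bdryPath_arc (by linarith [Real.pi_pos]) le_rfl]
    simp only [sub_self, add_zero, ofReal_one, one_mul]
    push_cast
    exact exp_pi_div_two_mul_I
  · rw [bdryPath, if_neg h0, if_neg (not_le.2 h)]

lemma exists_bdryPath_eq {z : ℂ} (hz : z ∈ Fplus) (h : z ∉ Fint) : ∃ s, bdryPath s = z := by
  have him := im_pos_of_mem_Fplus hz
  obtain ⟨h1, h2, h3, -⟩ := mem_Fplus.1 hz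
  rcases Fplus_cases hz with h' | h' | h' | h'
  · exact (h h').elim
  · refine ⟨π / 2 + (z.im - 1), ?_⟩
    rw [one_le_norm_iff, h'] at h3
    rw [bdryPath_left (by nlinarith)]
    apply Complex.ext <;> simp [h']
  · refine ⟨π / 3 - (z.im - √3 / 2), ?_⟩
    have h4 : √3 / 2 ≤ z.im := by
      rw [div_le_iff₀ two_pos, Real.sqrt_le_left (by linarith)]
      linarith [three_quarters_le_im_sq hz]
    rw [bdryPath_right (by linarith)]
    apply Complex.ext <;> simp [h', zeta_re, zeta_im]
  · refine ⟨z.arg, ?_⟩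
    have hre : Real.cos z.arg = z.re := by
      have := congrArg re (eq_exp_arg h')
      rw [exp_ofReal_mul_I_re] at this
      exact this.symm
    have hsin : Real.sin z.arg = z.im := by
      have := congrArg im (eq_exp_arg h')
      rw [exp_ofReal_mul_I_im] at this
      exact this.symm
    have harg0 : 0 ≤ z.arg := arg_nonneg_iff.2 him.le
    rw [bdryPath_arc ?_ ?_, ← eq_exp_arg h']
    · by_contra! hlt
      have := Real.cos_lt_cos_of_nonneg_of_le_pi harg0 (by linarith [Real.pi_pos]) hlt
      rw [Real.cos_pi_div_three, hre] at this
      linarith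
    · by_contra! hlt
      have := Real.cos_neg_of_pi_div_two_lt_of_lt hlt
        (by linarith [arg_le_pi z, Real.pi_pos])
      rw [hre] at this
      linarith

lemma bdryPath_mem (s : ℝ) : bdryPath s ∈ Fplus ∧ bdryPath s ∉ Fint := by
  have hpi := Real.pi_pos
  have h3 : (√3 / 2) ^ 2 = 3 / 4 := by rw [div_pow, Real.sq_sqrt (by norm_num)]; norm_num
  have h3' : 0 < √3 / 2 := by positivity
  rcases le_total s (π / 3) with h | h
  · have hre : (bdryPath s).re = 1 / 2 := by rw [bdryPath_right h]; simp [zeta_re]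
    have him : (bdryPath s).im = √3 / 2 + (π / 3 - s) := by
      rw [bdryPath_right h]; simp [zeta_im]
    refine ⟨mem_Fplus.2 ⟨by rw [hre]; norm_num, hre.le, ?_, by rw [him]; linarith⟩,
      fun h' ↦ by linarith [h'.2.1]⟩
    rw [one_le_norm_iff, hre, him]
    nlinarith
  rcases le_total s (π / 2) with h' | h'
  · have hre : (bdryPath s).re = Real.cos s := by rw [bdryPath_arc h h', exp_ofReal_mul_I_re]
    have him : (bdryPath s).im = Real.sin s := by rw [bdryPath_arc h h', exp_ofReal_mul_I_im]
    have hn : ‖bdryPath s‖ = 1 := by rw [bdryPath_arc h h', norm_exp_ofReal_mul_I]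
    refine ⟨mem_Fplus.2 ⟨?_, ?_, hn.ge, ?_⟩, fun h' ↦ by linarith [h'.2.2.1]⟩
    · rw [hre]
      exact Real.cos_nonneg_of_mem_Icc ⟨by linarith, h'⟩
    · rw [hre, ← Real.cos_pi_div_three]
      exact Real.cos_le_cos_of_nonneg_of_le_pi (by positivity) (by linarith) h
    · rw [him]
      exact Real.sin_pos_of_pos_of_lt_pi (by linarith) (by linarith)
  · have hre : (bdryPath s).re = 0 := by rw [bdryPath_left h', re_ofReal_mul, I_re, mul_zero]
    have him : (bdryPath s).im = 1 + (s - π / 2) := by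
      rw [bdryPath_left h', im_ofReal_mul, I_im, mul_one]
    refine ⟨mem_Fplus.2 ⟨hre.ge, by rw [hre]; norm_num, ?_, by rw [him]; linarith⟩,
      fun h' ↦ by linarith [h'.1]⟩
    rw [one_le_norm_iff, hre, him]
    nlinarith

lemma im_deriv_j_left {z : ℂ} (hz : z ∈ Fplus) (h : z.re = 0) : (deriv j z).im ≤ 0 := by
  have him := im_pos_of_mem_Fplus hz
  have h3 := one_le_norm_iff.1 (mem_Fplus.1 hz).2.2.1
  have := im_deriv_mul_nonpos_of_ray (v := 1) him (im_j_eq_zero_of_re_eq_zero him h) (by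
    filter_upwards [eventually_ray (isOpen_lt continuous_re continuous_const)
      (show z.re < 1 / 2 by rw [h]; norm_num) 1, self_mem_nhdsWithin] with t h1 h2
    have h2' : 0 < t := h2
    refine mem_Fplus.2 ⟨by simp [h, h2'.le], le_of_lt h1, ?_, by simpa using him⟩
    rw [one_le_norm_iff]
    simp only [mul_one, add_re, add_im, ofReal_re, ofReal_im]
    nlinarith [sq_nonneg t])
  simpa using this

lemma im_deriv_j_right {z : ℂ} (hz : z ∈ Fplus) (h : z.re = 1 / 2) (h1 : 1 < ‖z‖) :
    0 ≤ (deriv j z).im := by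
  have him := im_pos_of_mem_Fplus hz
  have := im_deriv_mul_nonpos_of_ray (v := -1) him (im_j_eq_zero_of_re_eq_half him h) (by
    filter_upwards [eventually_ray (isOpen_lt continuous_const continuous_re)
      (show 0 < z.re by rw [h]; norm_num) (-1),
      eventually_ray (isOpen_lt continuous_const continuous_norm) h1 (-1),
      self_mem_nhdsWithin] with t h2 h3 h4
    have h4' : 0 < t := h4
    exact mem_Fplus.2 ⟨le_of_lt h2, by simp [h, h4'.le], le_of_lt h3, by simpa using him⟩)
  simpa using this

lemma monotoneOn_re_j_comp {γ : ℝ → ℂ} {v : ℝ → ℂ} {D : Set ℝ} (hD : Convex ℝ D)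
    (hγ : ∀ s ∈ D, HasDerivAt γ (v s) s) (him : ∀ s ∈ D, 0 < (γ s).im)
    (h : ∀ s ∈ interior D, 0 ≤ (deriv j (γ s) * v s).re) :
    MonotoneOn (fun s ↦ (j (γ s)).re) D := by
  have hd (s : ℝ) (hs : s ∈ D) :
      HasDerivAt (fun s ↦ (j (γ s)).re) (deriv j (γ s) * v s).re s :=
    reCLM.hasFDerivAt.comp_hasDerivAt s
      ((differentiableAt_j (him s hs)).hasDerivAt.comp s (hγ s hs))
  refine monotoneOn_of_deriv_nonneg hD (fun s hs ↦ (hd s hs).continuousAt.continuousWithinAt)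
    (fun s hs ↦ (hd s (interior_subset hs)).differentiableAt.differentiableWithinAt)
    fun s hs ↦ ?_
  rw [(hd s (interior_subset hs)).deriv]
  exact h s hs

/-- The path keeps `F₊` on its right, so `-iv` points inwards for a tangent `v`. As `Im j` vanishes
on the path and is nonpositive inside, `Im (j' · (-iv)) ≤ 0`, that is `Re (j' v) ≥ 0`. -/
theorem monotone_re_j_bdryPath : Monotone fun s ↦ (j (bdryPath s)).re := by
  have hpi := Real.pi_pos
  have him (s : ℝ) : 0 < (bdryPath s).im := im_pos_of_mem_Fplus (bdryPath_mem s).1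
  have m1 : MonotoneOn (fun s ↦ (j (bdryPath s)).re) (Set.Iic (π / 3)) := by
    have := monotoneOn_re_j_comp (γ := fun s : ℝ ↦ zeta + ((π / 3 - s : ℝ) : ℂ) * I)
      (v := fun _ ↦ -I) (convex_Iic (π / 3)) (fun s _ ↦ ?_) (fun s hs ↦ ?_) (fun s hs ↦ ?_)
    · refine this.congr fun s hs ↦ ?_
      simp only [bdryPath_right hs]
    · have h1 : HasDerivAt (fun s : ℝ ↦ ((π / 3 - s : ℝ) : ℂ)) ((-1 : ℝ) : ℂ) s :=
        ((hasDerivAt_id s).const_sub (π / 3)).ofReal_comp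
      simpa using (h1.mul_const I).const_add zeta
    · rw [← bdryPath_right hs]
      exact him s
    · rw [interior_Iic] at hs
      have hs' : s < π / 3 := hs
      have hF := (bdryPath_mem s).1
      rw [bdryPath_right hs'.le] at hF
      have := im_deriv_j_right hF (by simp [zeta_re]) (by
        rw [one_lt_norm_iff]
        have h3 : (√3 / 2) ^ 2 = 3 / 4 := by
          rw [div_pow, Real.sq_sqrt (by norm_num)]; norm_num
        have h3' : 0 < √3 / 2 := by positivity
        rw [add_re, add_im, zeta_re, zeta_im, re_ofReal_mul, im_ofReal_mul, I_re, I_im]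
        nlinarith)
      simpa using this
  have m2 : MonotoneOn (fun s ↦ (j (bdryPath s)).re) (Set.Icc (π / 3) (π / 2)) := by
    have := monotoneOn_re_j_comp (γ := fun s : ℝ ↦ cexp (s * I))
      (v := fun s ↦ cexp (s * I) * I) (convex_Icc (π / 3) (π / 2)) (fun s _ ↦ ?_)
      (fun s hs ↦ ?_) (fun s hs ↦ ?_)
    · refine this.congr fun s hs ↦ ?_
      simp only [bdryPath_arc hs.1 hs.2]
    · simpa using ((ofRealCLM.hasDerivAt (x := s)).mul_const I).cexp
    · rw [← bdryPath_arc hs.1 hs.2]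
      exact him s
    · rw [interior_Icc] at hs
      have hF := (bdryPath_mem s).1
      rw [bdryPath_arc hs.1.le hs.2.le] at hF
      have := im_deriv_j_mul_arc (im_pos_of_mem_Fplus hF) (mem_Fplus.1 hF).1 (by
        rw [exp_ofReal_mul_I_re, ← Real.cos_pi_div_three]
        exact Real.cos_lt_cos_of_nonneg_of_le_pi (by positivity) (by linarith [hs.2]) hs.1)
        (norm_exp_ofReal_mul_I s)
      rw [← mul_assoc, mul_re, I_re, I_im]
      linarith
  have m3 : MonotoneOn (fun s ↦ (j (bdryPath s)).re) (Set.Ici (π / 2)) := by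
    have := monotoneOn_re_j_comp (γ := fun s : ℝ ↦ ((1 + (s - π / 2) : ℝ) : ℂ) * I)
      (v := fun _ ↦ I) (convex_Ici (π / 2)) (fun s _ ↦ ?_) (fun s hs ↦ ?_) (fun s hs ↦ ?_)
    · refine this.congr fun s hs ↦ ?_
      simp only [bdryPath_left hs]
    · have h1 : HasDerivAt (fun s : ℝ ↦ ((1 + (s - π / 2) : ℝ) : ℂ)) ((1 : ℝ) : ℂ) s :=
        (((hasDerivAt_id s).sub_const (π / 2)).const_add 1).ofReal_comp
      simpa using h1.mul_const I
    · rw [← bdryPath_left hs]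
      exact him s
    · have hs' : π / 2 ≤ s := interior_subset hs
      have hF := (bdryPath_mem s).1
      rw [bdryPath_left hs'] at hF
      have := im_deriv_j_left hF (by rw [re_ofReal_mul, I_re, mul_zero])
      simpa using this
  have m12 : MonotoneOn (fun s ↦ (j (bdryPath s)).re) (Set.Iic (π / 2)) := by
    rw [← Set.Iic_union_Icc_eq_Iic (show π / 3 ≤ π / 2 by linarith)]
    exact m1.union_right m2 isGreatest_Iic (isLeast_Icc (by linarith))
  exact m12.Iic_union_Ici m3

/-- For `ξ` on the boundary, distances of values of `j` on the boundary outside a disc around `ξ`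
are bounded below by those on the bounding circle. -/
theorem norm_j_sub_ge_of_circle_of_bdry {ξ τ : ℂ} (hξ : ξ ∈ Fplus) (hξ' : ξ ∉ Fint)
    (hτ : τ ∈ Fplus) (hτ' : τ ∉ Fint) {δ m : ℝ} (hδ : 0 ≤ δ) (hdist : δ ≤ ‖τ - ξ‖)
    (hm : ∀ z : ℂ, ‖z - ξ‖ = δ → m ≤ ‖j z - j ξ‖) : m ≤ ‖j τ - j ξ‖ := by
  obtain ⟨s, rfl⟩ := exists_bdryPath_eq hξ hξ'
  obtain ⟨t, rfl⟩ := exists_bdryPath_eq hτ hτ'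
  have hreal (u : ℝ) : j (bdryPath u) = ((j (bdryPath u)).re : ℂ) := by
    apply Complex.ext
    · simp
    · simp [im_j_eq_zero_of_notMem_Fint (bdryPath_mem u).1 (bdryPath_mem u).2]
  have hnorm (u : ℝ) : ‖j (bdryPath u) - j (bdryPath s)‖ =
      |(j (bdryPath u)).re - (j (bdryPath s)).re| := by
    rw [hreal u, hreal s, ← ofReal_sub, Complex.norm_real, Real.norm_eq_abs]
    simp
  have hcont : Continuous fun u ↦ ‖bdryPath u - bdryPath s‖ :=
    (continuous_bdryPath.sub continuous_const).norm
  -- Between `ξ` and `τ` the path meets the circle; by monotonicity the value at `τ` is at least as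
  -- far from `j(ξ)` as the value there.
  obtain ⟨u, hu, hud⟩ := intermediate_value_uIcc (a := s) (b := t) hcont.continuousOn
    (show δ ∈ _ by
      rw [sub_self, norm_zero, Set.uIcc_of_le (hδ.trans hdist)]
      exact ⟨hδ, hdist⟩)
  refine (hm _ hud).trans ?_
  rw [hnorm, hnorm]
  rcases le_total s t with hst | hst
  · rw [Set.uIcc_of_le hst] at hu
    have h1 := monotone_re_j_bdryPath hu.1
    have h2 := monotone_re_j_bdryPath hu.2
    simp only at h1 h2
    rw [abs_of_nonneg (by linarith), abs_of_nonneg (by linarith)]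
    linarith
  · rw [Set.uIcc_of_ge hst] at hu
    have h1 := monotone_re_j_bdryPath hu.1
    have h2 := monotone_re_j_bdryPath hu.2
    simp only at h1 h2
    rw [abs_of_nonpos (by linarith), abs_of_nonpos (by linarith)]
    linarith

/-! ### Size of `j` near a point of `F₊` -/

lemma im_bound_of_near {ξ z : ℂ} (hξ : ξ ∈ Fplus) (hz : ‖z - ξ‖ < 1 / 6) :
    0.6993 < z.im ∧ z.im < ξ.im + 1 / 6 := by
  have h1 := abs_lt.1 ((abs_im_le_norm (z - ξ)).trans_lt hz)
  rw [sub_im] at h1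
  have h2 : 0.866 ≤ ξ.im := by
    have := three_quarters_le_im_sq hξ
    have := im_pos_of_mem_Fplus hξ
    norm_num
    nlinarith
  norm_num at h2 ⊢
  constructor <;> linarith [h1.1, h1.2]

lemma norm_nome_le_of_near {ξ z : ℂ} (hξ : ξ ∈ Fplus) (hz : ‖z - ξ‖ < 1 / 6) :
    ‖nome z‖ ≤ 1 / 80 := by
  have h1 := (im_bound_of_near hξ hz).1
  rw [norm_nome, Real.exp_neg, one_div]
  refine inv_anti₀ (by norm_num) ?_
  -- The height bound 0.6993 is just below `√3/2 - 1/6`, and `exp 4.391` only just exceeds 80.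
  have h2 : 4 + 0.391 ≤ 2 * π * z.im := by nlinarith [Real.pi_gt_d4]
  refine le_trans ?_ (Real.exp_le_exp.2 h2)
  have h3 := Real.quadratic_le_exp_of_nonneg (x := 0.391) (by norm_num)
  have h4 : Real.exp 4 = Real.exp 1 ^ 4 := by rw [← Real.exp_nat_mul]; norm_num
  have h5 : (2.718 : ℝ) ^ 4 ≤ Real.exp 1 ^ 4 :=
    pow_le_pow_left₀ (by norm_num) (by linarith [Real.exp_one_gt_d9]) 4
  rw [Real.exp_add, h4]
  calc (80 : ℝ) ≤ 2.718 ^ 4 * (1 + 0.391 + 0.391 ^ 2 / 2) := by norm_num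
    _ ≤ _ := mul_le_mul h5 h3 (by norm_num) (by positivity)

lemma exp_pi_div_three_le : Real.exp (π / 3) ≤ 3 := by
  have h1 : π / 3 ≤ 1 + 0.05 := by linarith [Real.pi_lt_d4]
  refine (Real.exp_le_exp.2 h1).trans ?_
  have h2 := Real.exp_bound_div_one_sub_of_interval (x := 0.05) (by norm_num) (by norm_num)
  rw [Real.exp_add]
  calc Real.exp 1 * Real.exp 0.05 ≤ 2.72 * (1 / (1 - 0.05)) :=
        mul_le_mul (by linarith [Real.exp_one_lt_d9]) h2 (Real.exp_pos _).le (by norm_num)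
    _ ≤ 3 := by norm_num

/-- Here `450 = 150 · 3`: moving up by at most 1/6 multiplies `|q|⁻¹` by at most `exp(π/3) ≤ 3`. -/
lemma norm_j_le_of_near {ξ z : ℂ} (hξ : ξ ∈ Fplus) (hz : ‖z - ξ‖ < 1 / 6) :
    ‖j z‖ ≤ 450 * ‖nome ξ‖⁻¹ := by
  have h1 := im_bound_of_near hξ hz
  have h2 := norm_j_le (by linarith) (norm_nome_le_of_near hξ hz)
  have h3 : ‖nome z‖⁻¹ ≤ 3 * ‖nome ξ‖⁻¹ := by
    rw [norm_nome, norm_nome, Real.exp_neg, Real.exp_neg, inv_inv, inv_inv]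
    have h4 : 2 * π * z.im ≤ π / 3 + 2 * π * ξ.im := by nlinarith [Real.pi_pos]
    refine (Real.exp_le_exp.2 h4).trans ?_
    rw [Real.exp_add]
    exact mul_le_mul_of_nonneg_right exp_pi_div_three_le (Real.exp_pos _).le
  linarith

lemma inv_norm_nome_le {ξ : ℂ} (hξ : ξ ∈ Fplus) : ‖nome ξ‖⁻¹ ≤ 500 * max 1 ‖j ξ‖ := by
  have hq := norm_pos_iff.2 (nome_ne_zero ξ)
  by_cases h : ‖nome ξ‖ ≤ 1 / 500
  · have h1 := le_norm_j (im_pos_of_mem_Fplus hξ) h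
    have h2 := le_max_right 1 ‖j ξ‖
    have h3 : 0 ≤ ‖j ξ‖ := norm_nonneg _
    linarith
  · have h1 : ‖nome ξ‖⁻¹ ≤ 500 := by
      rw [inv_le_comm₀ hq (by norm_num)]
      linarith
    linarith [le_max_left 1 ‖j ξ‖]

lemma norm_j_sub_le_of_near {ξ z : ℂ} (hξ : ξ ∈ Fplus) (hz : ‖z - ξ‖ < 1 / 6) :
    ‖j z - j ξ‖ ≤ 3 / 2 * B ξ := by
  have h1 := norm_j_le_of_near hξ hz
  have h2 := inv_norm_nome_le hξ
  have h3 := norm_sub_le (j z) (j ξ)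
  have h4 := le_max_right 1 ‖j ξ‖
  have h5 := le_max_left 1 ‖j ξ‖
  rw [B]
  linarith

lemma I_mem_Fplus : I ∈ Fplus := mem_Fplus.2 (by simp)

lemma I_notMem_Fint : I ∉ Fint := fun h ↦ by simpa using h.1

/-- At `i` the general constant 3/2 is too large for a degree-2 leading term. The gain comes from
`|j(i)| ≥ |q|⁻¹/10`, which bounds the difference by a multiple of `|j(i)|` itself. -/
lemma norm_j_sub_le_of_near_I {z : ℂ} (hz : ‖z - I‖ < 1 / 6) : ‖j z - j I‖ ≤ B I / 8 := by
  have e : ‖nome I‖⁻¹ = Real.exp (2 * π) := by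
    rw [norm_nome, Real.exp_neg, inv_inv, I_im, mul_one]
  have h6 : Real.exp 6 = Real.exp 1 ^ 6 := by rw [← Real.exp_nat_mul]; norm_num
  have hlow : 500 ≤ ‖nome I‖⁻¹ := by
    have h1 : 6 + 0.28 ≤ 2 * π := by linarith [Real.pi_gt_d4]
    rw [e]
    refine le_trans ?_ (Real.exp_le_exp.2 h1)
    have h5 : (2.718 : ℝ) ^ 6 ≤ Real.exp 1 ^ 6 :=
      pow_le_pow_left₀ (by norm_num) (by linarith [Real.exp_one_gt_d9]) 6
    rw [Real.exp_add, h6]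
    calc (500 : ℝ) ≤ 2.718 ^ 6 * (0.28 + 1) := by norm_num
      _ ≤ _ := mul_le_mul h5 (Real.add_one_le_exp _) (by norm_num) (by positivity)
  have hupp : ‖nome I‖⁻¹ ≤ 600 := by
    have h1 : 2 * π ≤ 6 + 0.284 := by linarith [Real.pi_lt_d4]
    rw [e]
    refine (Real.exp_le_exp.2 h1).trans ?_
    have h2 := Real.exp_bound_div_one_sub_of_interval (x := 0.284) (by norm_num) (by norm_num)
    have h5 : Real.exp 1 ^ 6 ≤ 2.719 ^ 6 :=
      pow_le_pow_left₀ (Real.exp_pos 1).le (by linarith [Real.exp_one_lt_d9]) 6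
    rw [Real.exp_add, h6]
    calc Real.exp 1 ^ 6 * Real.exp 0.284 ≤ 2.719 ^ 6 * (1 / (1 - 0.284)) :=
          mul_le_mul h5 h2 (Real.exp_pos _).le (by norm_num)
      _ ≤ 600 := by norm_num
  have h1 := norm_j_le_of_near I_mem_Fplus hz
  have h2 := norm_j_le_of_near I_mem_Fplus (z := I) (by norm_num)
  have h3 := le_norm_j (z := I) (by simp) (by
    rw [one_div]
    exact (le_inv_comm₀ (by norm_num) (norm_pos_iff.2 (nome_ne_zero I))).1 hlow)
  have h4 := norm_sub_le (j z) (j I)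
  have h5 := le_max_right 1 ‖j I‖
  rw [B]
  linarith

lemma B_pos (ξ : ℂ) : 0 < B ξ := by
  have := le_max_left 1 ‖j ξ‖
  rw [B]
  positivity

/-! ### Lower bounds on small circles -/

/-- If `f - f(c)` has leading term `a (z - c)ⁿ` at `c`, then `|f - f(c)|` is at least half of that
on sufficiently small circles around `c`. -/
lemma half_le_norm_sub_of_leading_term {f : ℂ → ℂ} {c a z : ℂ} {r M : ℝ} {n : ℕ}
    (hf : DifferentiableOn ℂ f (Metric.ball c r)) (hn : n ≠ 0)
    (hM : ∀ w, ‖w - c‖ < r → ‖f w - f c‖ ≤ M)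
    (ho : (fun w ↦ f w - f c - a * (w - c) ^ n) =o[𝓝 c] (fun w ↦ ‖w - c‖ ^ n))
    (hr : 0 < r) (hz : ‖z - c‖ < r) (hzM : (M + ‖a‖ * r ^ n) * ‖z - c‖ ≤ ‖a‖ / 2 * r ^ (n + 1)) :
    ‖a‖ * ‖z - c‖ ^ n / 2 ≤ ‖f z - f c‖ := by
  set g : ℂ → ℂ := fun w ↦ f w - f c - a * (w - c) ^ n with hg
  have hgc : g c = 0 := by simp [hg, hn]
  have hgd : DifferentiableOn ℂ g (Metric.ball c r) :=
    (hf.sub_const _).sub (by fun_prop)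
  have hmaps : Set.MapsTo g (Metric.ball c r) (Metric.closedBall (g c) (M + ‖a‖ * r ^ n)) := by
    intro w hw
    rw [Metric.mem_ball, dist_eq_norm] at hw
    rw [hgc, mem_closedBall_zero_iff]
    refine (norm_sub_le _ _).trans (add_le_add (hM w hw) ?_)
    rw [norm_mul, norm_pow]
    gcongr
  -- Schwarz lemma for a remainder vanishing to order above `n`: `|g(z)| ≤ (M + |a|rⁿ)(|z -
  -- c|/r)ⁿ⁺¹`. By `hzM` this is at most half the leading term.
  have h1 := dist_le_mul_div_pow_of_mapsTo_ball_of_isLittleO hgd hmaps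
    (by simpa [hgc] using ho) (show z ∈ Metric.ball c r by rwa [Metric.mem_ball, dist_eq_norm])
  rw [hgc, dist_zero_right, dist_eq_norm, div_pow, ← mul_div_assoc, le_div_iff₀ (by positivity),
    pow_succ ‖z - c‖] at h1
  have h2 : ‖g z‖ ≤ ‖a‖ / 2 * ‖z - c‖ ^ n := by
    have h3 := mul_le_mul_of_nonneg_right hzM (pow_nonneg (norm_nonneg (z - c)) n)
    refine le_of_mul_le_mul_right ?_ (pow_pos hr (n + 1))
    linarith
  have h4 : ‖a * (z - c) ^ n‖ ≤ ‖f z - f c‖ + ‖g z‖ := by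
    have := norm_sub_le (f z - f c) (g z)
    simpa [hg] using this
  rw [norm_mul, norm_pow] at h4
  linarith

lemma differentiableOn_j_ball {ξ : ℂ} (hξ : ξ ∈ Fplus) :
    DifferentiableOn ℂ j (Metric.ball ξ (1 / 6)) := fun z hz ↦ by
  rw [Metric.mem_ball, dist_eq_norm] at hz
  exact (differentiableAt_j (by linarith [(im_bound_of_near hξ hz).1])).differentiableWithinAt

lemma A_of_ne {ξ : ℂ} (h : ξ ≠ I) : A ξ = ‖deriv j ξ‖ := if_neg h

lemma A_I : A I = ‖iteratedDeriv 2 j I‖ := if_pos rfl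

lemma A_pos {ξ : ℂ} (hξ : ξ ∈ Fplus) (hζ : ξ ≠ zeta) : 0 < A ξ := by
  rcases eq_or_ne ξ I with rfl | h
  · rw [A_I]
    exact norm_pos_iff.2 iteratedDeriv_two_j_I_ne_zero
  · rw [A_of_ne h]
    exact norm_pos_iff.2 (deriv_j_ne_zero hξ h hζ)

lemma lt_of_le_ratio {a b δ : ℝ} (ha : 0 ≤ a) (hb : 0 < b) (hδ : δ ≤ a / (12 * a + 108 * b)) :
    δ < 1 / 6 ∧ δ * (12 * a + 108 * b) ≤ a := by
  have h0 : 0 < 12 * a + 108 * b := by positivity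
  refine ⟨hδ.trans_lt ?_, (le_div_iff₀ h0).1 hδ⟩
  rw [div_lt_iff₀ h0]
  linarith

lemma circle_bound {ξ z : ℂ} (hξ : ξ ∈ Fplus) (hi : ξ ≠ I)
    (hz : ‖z - ξ‖ ≤ A ξ / (12 * A ξ + 108 * B ξ)) : A ξ * ‖z - ξ‖ / 2 ≤ ‖j z - j ξ‖ := by
  have hA : 0 ≤ A ξ := by rw [A_of_ne hi]; positivity
  obtain ⟨h1, h2⟩ := lt_of_le_ratio hA (B_pos ξ) hz
  rw [A_of_ne hi] at *
  have ho := (hasDerivAt_iff_isLittleO.1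
    (differentiableAt_j (im_pos_of_mem_Fplus hξ)).hasDerivAt).norm_right
  -- With `r = 1/6` and `M = 3B/2`, the smallness condition times 72 is exactly `(12A + 108B)|z - ξ|
  -- ≤ A`.
  have := half_le_norm_sub_of_leading_term (a := deriv j ξ) (n := 1) (z := z)
    (differentiableOn_j_ball hξ) one_ne_zero (fun w hw ↦ norm_j_sub_le_of_near hξ hw)
    (by simpa [mul_comm] using ho) (by norm_num) h1 (by linarith)
  simpa using this

lemma circle_bound_I {z : ℂ} (hz : ‖z - I‖ ≤ A I / (12 * A I + 108 * B I)) :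
    A I * ‖z - I‖ ^ 2 / 4 ≤ ‖j z - j I‖ := by
  have hA : 0 ≤ A I := by rw [A_I]; positivity
  obtain ⟨h1, h2⟩ := lt_of_le_ratio hA (B_pos I) hz
  obtain ⟨g, hg, -, hev, hgI⟩ := exists_expansion_j_I
  have hAg : A I = 2 * ‖g I‖ := by rw [A_I, hgI, norm_mul, Complex.norm_ofNat]
  have ho : (fun w ↦ j w - j I - g I * (w - I) ^ 2) =o[𝓝 I] (fun w ↦ ‖w - I‖ ^ 2) := by
    have h3 : (fun w ↦ g w - g I) =o[𝓝 I] (fun _ ↦ (1 : ℝ)) := by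
      rw [Asymptotics.isLittleO_one_iff]
      simpa using hg.tendsto.sub_const (g I)
    have h4 := (Asymptotics.isBigO_refl (fun w : ℂ ↦ (w - I) ^ 2) (𝓝 I)).norm_right.mul_isLittleO h3
    refine h4.congr' ?_ (by simp)
    filter_upwards [hev] with w hw
    rw [hw]
    ring
  -- With `|a| = A/2`, `r = 1/6` and `M = B/8`, the condition times 864 is again `(12A + 108B)|z -
  -- i| ≤ A`.
  have := half_le_norm_sub_of_leading_term (a := g I) (n := 2) (z := z)
    (differentiableOn_j_ball I_mem_Fplus) two_ne_zero (fun w hw ↦ norm_j_sub_le_of_near_I hw)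
    ho (by norm_num) h1 (by rw [hAg] at h2; linarith)
  rw [hAg]
  linarith

/-! ### Positivity of `δ` -/

lemma zeta_mem_Fplus : zeta ∈ Fplus := by
  have := (bdryPath_mem (π / 3)).1
  rw [bdryPath_right le_rfl] at this
  simpa using this

lemma isClosed_nonempty_of_mem_sides {g : Set ℂ} (hg : g ∈ sides) : IsClosed g ∧ g.Nonempty := by
  rcases hg with rfl | rfl | rfl
  · exact ⟨isClosed_Fplus.inter (isClosed_eq continuous_re continuous_const),
      I, I_mem_Fplus, by simp⟩
  · exact ⟨isClosed_Fplus.inter (isClosed_eq continuous_re continuous_const),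
      zeta, zeta_mem_Fplus, zeta_re⟩
  · exact ⟨isClosed_Fplus.inter (isClosed_eq continuous_norm continuous_const),
      I, I_mem_Fplus, by simp⟩

lemma delta_pos {ξ : ℂ} (hA : 0 < A ξ) : 0 < delta ξ := by
  have hB := B_pos ξ
  rcases (delta_isLeast ξ).1 with h | ⟨g, ⟨hg, hξg⟩, h⟩
  · rw [h]
    positivity
  · rw [← h]
    obtain ⟨hc, hne⟩ := isClosed_nonempty_of_mem_sides hg
    exact half_pos ((hc.notMem_iff_infDist_pos hne).1 hξg)

lemma delta_le (ξ : ℂ) : delta ξ ≤ A ξ / (12 * A ξ + 108 * B ξ) :=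
  (delta_isLeast ξ).2 (Set.mem_insert _ _)

/-! ### The lower bound outside a disc -/

/-- The maximum principle for `1/(j - j(ξ))` outside the disc; `hne` excludes interior poles, `hbd`
those on `∂F₊`, and the growth of `j` settles `i∞`. -/
lemma le_norm_j_sub_of_boundary {ξ : ℂ} {δ m : ℝ} (hδ : 0 < δ) (hm : 0 < m)
    (hcirc : ∀ z : ℂ, ‖z - ξ‖ = δ → m ≤ ‖j z - j ξ‖)
    (hbd : ∀ z ∈ Fplus, z ∉ Fint → δ ≤ ‖z - ξ‖ → m ≤ ‖j z - j ξ‖)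
    (hne : ∀ z ∈ Fint, z ≠ ξ → j z ≠ j ξ) {τ : ℂ} (hτ : τ ∈ Fplus) (hdist : δ ≤ ‖τ - ξ‖) :
    m ≤ ‖j τ - j ξ‖ := by
  by_cases hτi : τ ∈ Fint
  swap
  · exact hbd τ hτ hτi hdist
  rcases hdist.eq_or_lt with h | hlt
  · exact hcirc τ h.symm
  set V : Set ℂ := Fint ∩ {z | δ < ‖z - ξ‖} with hV
  have hVF : V ⊆ Fplus := fun z hz ↦ Fint_subset_Fplus hz.1
  have hcl {z : ℂ} (hz : z ∈ closure V) : z ∈ Fplus ∧ δ ≤ ‖z - ξ‖ := by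
    refine ⟨closure_subset_Fplus hVF hz, ?_⟩
    have : closure V ⊆ {z | δ ≤ ‖z - ξ‖} := closure_minimal
      (fun w hw ↦ Set.mem_ofPred.2 (le_of_lt (Set.mem_ofPred.1 hw.2)))
      (isClosed_le continuous_const (by fun_prop))
    exact this hz
  have hne' {z : ℂ} (hz : z ∈ closure V) : j z - j ξ ≠ 0 := by
    obtain ⟨h1, h2⟩ := hcl hz
    by_cases h3 : z ∈ Fint
    · refine sub_ne_zero.2 (hne z h3 ?_)
      rintro rfl
      rw [sub_self, norm_zero] at h2
      linarith
    · exact norm_pos_iff.1 (hm.trans_le (hbd z h1 h3 h2))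
  have h := norm_le_of_boundary (V := V) (f := fun z ↦ (j z - j ξ)⁻¹) (C := m⁻¹)
    (isOpen_Fint.inter (isOpen_lt continuous_const (by fun_prop))) hVF (fun z hz ↦ ?_)
    (fun z hz hzV ↦ ?_) (fun ε hε ↦ ?_) (z := τ) ⟨hτi, hlt⟩
  · rw [norm_inv] at h
    exact (inv_le_inv₀ (norm_pos_iff.2 (hne' (subset_closure ⟨hτi, hlt⟩))) hm).1 h
  · exact ((differentiableAt_j (im_pos_of_mem_Fplus (hcl hz).1)).sub_const _).inv (hne' hz)
  · obtain ⟨h1, h2⟩ := hcl hz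
    rw [norm_inv]
    refine inv_anti₀ hm ?_
    by_cases h3 : z ∈ Fint
    · exact hcirc z (le_antisymm (not_lt.1 fun h4 ↦ hzV ⟨h3, h4⟩) h2)
    · exact hbd z h1 h3 h2
  · obtain ⟨Y, hY⟩ := exists_le_norm_j (m + ‖j ξ‖)
    refine ⟨Y, fun z _ hz ↦ ?_⟩
    rw [norm_inv]
    have h1 : m ≤ ‖j z - j ξ‖ := by linarith [hY z hz, norm_sub_norm_le (j z) (j ξ)]
    linarith [inv_anti₀ hm h1]

/-- For such `ξ` the value `j(ξ)` is real, hence not attained in the interior, where `Im j < 0`. -/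
lemma le_norm_j_sub_of_bdry_point {ξ : ℂ} (hξ : ξ ∈ Fplus) (hξ' : ξ ∉ Fint) {δ m : ℝ}
    (hδ : 0 < δ) (hm : 0 < m) (hcirc : ∀ z : ℂ, ‖z - ξ‖ = δ → m ≤ ‖j z - j ξ‖) {τ : ℂ}
    (hτ : τ ∈ Fplus) (hdist : δ ≤ ‖τ - ξ‖) : m ≤ ‖j τ - j ξ‖ := by
  refine le_norm_j_sub_of_boundary hδ hm hcirc (fun z hz hz' hd ↦
    norm_j_sub_ge_of_circle_of_bdry hξ hξ' hz hz' hδ.le hd hcirc) (fun z hz _ h ↦ ?_) hτ hdist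
  have := im_j_neg hz
  rw [h, im_j_eq_zero_of_notMem_Fint hξ hξ'] at this
  exact lt_irrefl _ this

lemma frontier_Fplus : frontier Fplus = Fplus \ Fint := by
  rw [isClosed_Fplus.frontier_eq, interior_Fplus]

end JBound

end

/-! ### The three cases of the bound -/

theorem mainTheorem7 (ξ : ℂ) (hξ : ξ ∈ JBound.Fplus) (hξζ : ξ ≠ JBound.zeta) :
    0 < JBound.c ξ ∧
      ∀ τ ∈ JBound.Fplus, JBound.delta ξ ≤ ‖τ - ξ‖ →
        JBound.c ξ ≤ ‖JBound.j τ - JBound.j ξ‖ := by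
  have hA := JBound.A_pos hξ hξζ
  have hδ := JBound.delta_pos hA
  have hδle := JBound.delta_le ξ
  by_cases hi : ξ = Complex.I
  · subst hi
    have hc : JBound.c Complex.I = JBound.A Complex.I * JBound.delta Complex.I ^ 2 / 4 :=
      if_pos rfl
    have hpos : 0 < JBound.c Complex.I := by rw [hc]; positivity
    refine ⟨hpos, fun τ hτ hd ↦ JBound.le_norm_j_sub_of_bdry_point hξ JBound.I_notMem_Fint hδ hpos
      (fun z hz ↦ ?_) hτ hd⟩
    rw [hc, ← hz]
    exact JBound.circle_bound_I (hz.trans_le hδle)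
  have hcirc (z : ℂ) (hz : ‖z - ξ‖ = JBound.delta ξ) :
      JBound.A ξ * JBound.delta ξ / 2 ≤ ‖JBound.j z - JBound.j ξ‖ := by
    rw [← hz]
    exact JBound.circle_bound hξ hi (hz.trans_le hδle)
  by_cases hF : ξ ∈ JBound.Fint
  · have hc : JBound.c ξ = min |(JBound.j ξ).im| (JBound.A ξ * JBound.delta ξ / 2) := by
      rw [JBound.c, if_neg hi, if_neg (by rw [JBound.frontier_Fplus]; exact fun h ↦ h.2 hF)]
    have hpos : 0 < JBound.c ξ := by
      rw [hc]
      exact lt_min (abs_pos.2 (JBound.im_j_neg hF).ne) (by positivity)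
    refine ⟨hpos, fun τ hτ hd ↦ JBound.le_norm_j_sub_of_boundary hδ hpos (fun z hz ↦ ?_)
      (fun z hz hz' _ ↦ ?_) (fun z hz hne h ↦ hne (JBound.injOn_j_Fint hz hF h)) hτ hd⟩
    · rw [hc]
      exact (min_le_right _ _).trans (hcirc z hz)
    · rw [hc]
      refine (min_le_left _ _).trans ?_
      -- Since `j(z)` is real on `∂F₊`, the difference has imaginary part `-Im j(ξ)`.
      have := Complex.abs_im_le_norm (JBound.j z - JBound.j ξ)
      rwa [Complex.sub_im, JBound.im_j_eq_zero_of_notMem_Fint hz hz', zero_sub, abs_neg] at this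
  · have hc : JBound.c ξ = JBound.A ξ * JBound.delta ξ / 2 := by
      rw [JBound.c, if_neg hi, if_pos (by rw [JBound.frontier_Fplus]; exact ⟨hξ, hF⟩)]
    have hpos : 0 < JBound.c ξ := by rw [hc]; positivity
    refine ⟨hpos, fun τ hτ hd ↦ JBound.le_norm_j_sub_of_bdry_point hξ hF hδ hpos
      (fun z hz ↦ ?_) hτ hd⟩
    rw [hc]
    exact hcirc z hz
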